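/- Conventions. Algebras are associative, unital and finite-dimensional over $\mathbb{R}$. A grading $\Gamma: R=\bigoplus_{g\in G}R_g$ of an algebra $R$ by an abelian group $G$ satisfies $R_gR_h\subseteq R_{gh}$, and $G$ is assumed to be generated by the support $\{g\in G : R_g\neq 0\}$. It is a \emph{division grading} if every nonzero homogeneous element is invertible. A grading $R=\bigoplus_{h\in H}R'_h$ is a \emph{refinement} of $\Gamma$ if every $R'_h$ is contained in some $R_g$, and it is a \emph{proper} refinement if moreover at least one of these containments with $R'_h\ne 0$ is strict; $\Gamma$ is \emph{fine} if no grading of $R$ by an abelian group is a proper refinement of $\Gamma$. Two graded algebras are \emph{equivalent} if there is an algebra isomorphism such that it and its inverse map every homogeneous component into a homogeneous component. The tensor product of a $G$-grading on $R$ and an $H$-grading on $S$ is the $G\times H$-grading $(R\otimes S)_{(g,h)}=R_g\otimes S_h$. For $p,m\ge 0$ let $C(p,m)$ be the Clifford algebra of $q=x_1^2+\dots+x_p^2-x_{p+1}^2-\dots-x_{p+m}^2$ on $\mathbb{R}^{p+m}$ with the convention $v^2=-q(v)$. The graded algebra $C^{\mathrm{gr}}(p,m)$ is $C(p,m)$ graded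 by $\mathbb{Z}_2^{p+m}$ so that the degrees of the standard basis vectors $e_1,\dots,e_{p+m}$ are the standard basis of $\mathbb{Z}_2^{p+m}$ (and $\deg(e_{i_1}\cdots e_{i_l})$ is the sum of the degrees of the factors). Let $M_2^{(4)}$ be $M_2(\mathbb{R})$ graded by $\mathbb{Z}_2\times\mathbb{Z}_2$ with the components $\langle I\rangle,\langle A\rangle,\langle B\rangle,\langle AB\rangle$ in degrees $(0,0),(1,0),(0,1),(1,1)$, where $A=\begin{pmatrix}1&0\\0&-1\end{pmatrix}$, $B=\begin{pmatrix}0&1\\1&0\end{pmatrix}$, and let $\mathbb{H}^{(4)}$ be the quaternion algebra with the components $\langle 1\rangle,\langle i\rangle,\langle j\rangle,\langle k\rangle$ in the same degrees. Proposition. (a) Let $\Gamma$ be a fine division grading by $G$ on a central simple real algebra $R$. Then all components of $\Gamma$ are one-dimensional, $G$ is an elementary abelian 2-group, and one of the following holds: (1) for some $k\ge 0$, $R$ is equivalent to $C^{\mathrm{gr}}(k,k)$ and has the graded presentation $$(x_1,\ldots,x_{2k}\;|\;x_p^2=-1\ (1\le p\le k),\ x_q^2=1\ (k+1\le q\le 2k),\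 x_ux_v=-x_vx_u\ (1\le u<v\le 2k));$$ (2) for some $k\ge 1$, $R$ is equivalent to $C^{\mathrm{gr}}(k+1,k-1)$ and has the graded presentation $$(x_1,\ldots,x_{2k}\;|\;x_p^2=-1\ (1\le p\le k+1),\ x_q^2=1\ (k+2\le q\le 2k),\ x_ux_v=-x_vx_u\ (1\le u<v\le 2k)).$$ Here "has the graded presentation" means: there is a basis $\alpha_1,\ldots,\alpha_{2k}$ of the elementary abelian 2-group $G$ (as a vector space over $\mathbb{Z}_2$) such that the algebra given by the presentation, graded by $\deg x_s=\alpha_s$, is isomorphic to $R$ by an algebra isomorphism that preserves degrees. (b) For every $k\ge 0$, $C^{\mathrm{gr}}(k,k)$ is a fine division grading with one-dimensional components, $C(k,k)\cong M_{2^k}(\mathbb{R})$ as algebras, $C^{\mathrm{gr}}(k,k)$ is equivalent to $(M_2^{(4)})^{\otimes k}$, and it has the graded presentation in (1). (c) For every $k\ge 1$, $C^{\mathrm{gr}}(k+1,k-1)$ is a fine division grading with one-dimensional components, $C(k+1,k-1)\cong M_{2^{k-1}}(\mathbb{H})$ as algebras, $C^{\mathrm{gr}}(k+1,k-1)$ is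 equivalent to $(M_2^{(4)})^{\otimes (k-1)}\otimes\mathbb{H}^{(4)}$, and it has the graded presentation in (2). -/

import Mathlib

open scoped TensorProduct Quaternion

universe u v

/-! ### Gradings, division gradings, fine gradings, equivalence -/

/-- The support of a grading: the set of degrees with a nonzero component. -/
def gradingSupport {G : Type u} {R : Type v} [Ring R] [Algebra ℝ R]
    (𝒜 : G → Submodule ℝ R) : Set G :=
  {g | 𝒜 g ≠ ⊥}

/-- A division grading: every nonzero homogeneous element is invertible. -/
def IsDivisionGrading {G : Type u} {R : Type v} [Ring R] [Algebra ℝ R]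
    (𝒜 : G → Submodule ℝ R) : Prop :=
  ∀ g : G, ∀ a ∈ 𝒜 g, a ≠ 0 → IsUnit a

/-- `ℬ` is a refinement of `𝒜`: every component of `ℬ` lies in a component of `𝒜`. -/
def IsRefinement {H : Type*} {G : Type*} {R : Type*} [Ring R] [Algebra ℝ R]
    (ℬ : H → Submodule ℝ R) (𝒜 : G → Submodule ℝ R) : Prop :=
  ∀ h : H, ∃ g : G, ℬ h ≤ 𝒜 g

/-- `ℬ` is a proper refinement of `𝒜`: it is a refinement, and for at least one element of its
support the containment is strict. -/
def IsProperRefinement {H : Type*} {G : Type*} {R : Type*} [Ring R] [Algebra ℝ R]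
    (ℬ : H → Submodule ℝ R) (𝒜 : G → Submodule ℝ R) : Prop :=
  IsRefinement ℬ 𝒜 ∧ ∃ h : H, ℬ h ≠ ⊥ ∧ ∃ g : G, ℬ h < 𝒜 g

/-- A fine grading: no grading of the algebra by an abelian group is a proper refinement. -/
def IsFineGrading {G : Type u} {R : Type v} [Ring R] [Algebra ℝ R]
    (𝒜 : G → Submodule ℝ R) : Prop :=
  ∀ (H : Type u) [AddCommGroup H] [DecidableEq H] (ℬ : H → Submodule ℝ R) [GradedAlgebra ℬ],
    ¬ IsProperRefinement ℬ 𝒜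

/-- Equivalence of gradings: an algebra isomorphism which, together with its inverse, maps every
component into some component. -/
def GradingEquivalent {G : Type*} {H : Type*} {R : Type*} {S : Type*} [Ring R] [Algebra ℝ R]
    [Ring S] [Algebra ℝ S] (𝒜 : G → Submodule ℝ R) (ℬ : H → Submodule ℝ S) : Prop :=
  ∃ φ : R ≃ₐ[ℝ] S,
    (∀ g : G, ∃ h : H, (𝒜 g).map φ.toLinearMap ≤ ℬ h) ∧
    (∀ h : H, ∃ g : G, (ℬ h).map φ.symm.toLinearMap ≤ 𝒜 g)

/-- Isomorphism of gradings by the same group: an algebra isomorphism that preserves degrees. -/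
def GradingIsomorphic {G : Type*} {R : Type*} {S : Type*} [Ring R] [Algebra ℝ R]
    [Ring S] [Algebra ℝ S] (𝒜 : G → Submodule ℝ R) (ℬ : G → Submodule ℝ S) : Prop :=
  ∃ φ : R ≃ₐ[ℝ] S, ∀ g : G, (𝒜 g).map φ.toLinearMap = ℬ g

/-- The components obtained by giving the elements `x i` the degrees `d i`: the component of
degree `g` is spanned by the monomials `x i₁ ⋯ x iₗ` with `d i₁ + ⋯ + d iₗ = g`. -/
def monomialGrading {ι : Type*} {G : Type*} [AddCommGroup G] {R : Type*} [Ring R] [Algebra ℝ R]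
    (x : ι → R) (d : ι → G) (g : G) : Submodule ℝ R :=
  Submodule.span ℝ {a | ∃ l : List ι, (l.map d).sum = g ∧ a = (l.map x).prod}

/-! ### Clifford algebras with the grading `C^gr(p, m)` -/

/-- The standard real quadratic form `x₁² + ⋯ + xₚ² - xₚ₊₁² - ⋯ - xₚ₊ₘ²`. -/
noncomputable def standardForm (p m : ℕ) : QuadraticForm ℝ (Fin (p + m) → ℝ) :=
  QuadraticMap.weightedSumSquares ℝ (fun i : Fin (p + m) => if i.val < p then (1 : ℝ) else -1)

/-- The Clifford algebra `C(p, m)` with the convention `x * x = -q x`: the first `p` basis vectors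
square to `-1`, the last `m` to `1`. -/
abbrev Cliff (p m : ℕ) : Type := CliffordAlgebra (-standardForm p m)

/-- The image in `C(p, m)` of the `i`-th vector of the standard orthogonal basis. -/
noncomputable def cliffGen (p m : ℕ) (i : Fin (p + m)) : Cliff p m :=
  CliffordAlgebra.ι (-standardForm p m) (Pi.single i 1)

/-- The grading `C^gr(p, m)` by an elementary abelian 2-group of rank `p + m`, in which the degrees
of the basis vectors form a basis. -/
noncomputable def cliffGrading (p m : ℕ) :
    (Fin (p + m) → ZMod 2) → Submodule ℝ (Cliff p m) :=
  monomialGrading (cliffGen p m) (fun i => Pi.single i 1)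

/-! ### The gradings `M_2^(4)` and `ℍ^(4)`, and tensor products of gradings -/

/-- The matrix `A = diag(1, -1)`. -/
noncomputable def sylvesterA : Matrix (Fin 2) (Fin 2) ℝ := !![1, 0; 0, -1]

/-- The matrix `B` that exchanges the two basis vectors. -/
noncomputable def sylvesterB : Matrix (Fin 2) (Fin 2) ℝ := !![0, 1; 1, 0]

/-- `M_2^(4)`: the grading of `M_2(ℝ)` by `ℤ/2 × ℤ/2` with components spanned by `I`, `A`, `B`,
`A * B`. -/
noncomputable def m2Grading (g : ZMod 2 × ZMod 2) : Submodule ℝ (Matrix (Fin 2) (Fin 2) ℝ) :=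
  Submodule.span ℝ {sylvesterA ^ g.1.val * sylvesterB ^ g.2.val}

/-- `ℍ^(4)`: the grading of the quaternions by `ℤ/2 × ℤ/2` with components spanned by `1`, `i`,
`j`, `k = i * j`. -/
noncomputable def quaternionGrading (g : ZMod 2 × ZMod 2) : Submodule ℝ ℍ[ℝ] :=
  Submodule.span ℝ {(⟨0, 1, 0, 0⟩ : ℍ[ℝ]) ^ g.1.val * (⟨0, 0, 1, 0⟩ : ℍ[ℝ]) ^ g.2.val}

/-- The algebra `M_2(ℝ)^{⊗ k}`. -/
abbrev M2Power (k : ℕ) : Type := ⨂[ℝ] _ : Fin k, Matrix (Fin 2) (Fin 2) ℝ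

/-- The tensor product grading `(M_2^(4))^{⊗ k}`, by the group `(ℤ/2 × ℤ/2)^k`. -/
noncomputable def m2PowerGrading (k : ℕ) (g : Fin k → ZMod 2 × ZMod 2) :
    Submodule ℝ (M2Power k) :=
  Submodule.span ℝ {t | ∃ a : Fin k → Matrix (Fin 2) (Fin 2) ℝ,
    (∀ i, a i ∈ m2Grading (g i)) ∧ t = PiTensorProduct.tprod ℝ a}

/-- The tensor product of two gradings, by the product of the grading groups. -/
noncomputable def tensorGrading {G : Type*} {H : Type*} {R : Type*} {S : Type*} [Ring R] [Algebra ℝ R]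
    [Ring S] [Algebra ℝ S] (𝒜 : G → Submodule ℝ R) (ℬ : H → Submodule ℝ S) (g : G × H) :
    Submodule ℝ (R ⊗[ℝ] S) :=
  Submodule.span ℝ {t | ∃ a ∈ 𝒜 g.1, ∃ b ∈ ℬ g.2, t = a ⊗ₜ[ℝ] b}

/-! ### Graded presentations by anticommuting generators -/

/-- The relations `x i * x i = ε i` and `x u * x v = - x v * x u` for `u < v`. -/
inductive AnticommRel {n : ℕ} (ε : Fin n → ℝ) :
    FreeAlgebra ℝ (Fin n) → FreeAlgebra ℝ (Fin n) → Prop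
  | sq (i : Fin n) :
      AnticommRel ε (FreeAlgebra.ι ℝ i * FreeAlgebra.ι ℝ i) (algebraMap ℝ _ (ε i))
  | anticomm (s t : Fin n) (h : s < t) :
      AnticommRel ε (FreeAlgebra.ι ℝ s * FreeAlgebra.ι ℝ t)
        (-(FreeAlgebra.ι ℝ t * FreeAlgebra.ι ℝ s))

/-- The algebra with generators `x i` and the relations above: the free associative unital algebra
modulo the two-sided ideal that they generate. -/
abbrev AnticommAlgebra {n : ℕ} (ε : Fin n → ℝ) : Type := RingQuot (AnticommRel ε)

/-- The generator `x i` of the presented algebra. -/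
noncomputable def anticommGen {n : ℕ} (ε : Fin n → ℝ) (i : Fin n) : AnticommAlgebra ε :=
  RingQuot.mkAlgHom ℝ (AnticommRel ε) (FreeAlgebra.ι ℝ i)

/-- The family `α` is a basis of `G`, seen as a vector space over `ℤ/2` (in particular `G` is an
elementary abelian 2-group). -/
def IsElementaryBasis {n : ℕ} {G : Type*} [AddCommGroup G] (α : Fin n → G) : Prop :=
  ∃ (_ : Module (ZMod 2) G) (b : Module.Basis (Fin n) (ZMod 2) G), ∀ i, b i = α i

/-- The graded algebra `𝒜` has the graded presentation with generators `x i`, relations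
`x i ^ 2 = ε i`, `x u * x v = - x v * x u` for `u < v`, and `deg (x i) = α i` for some basis `α` of
the grading group, an elementary abelian 2-group. -/
def HasAnticommPresentation {n : ℕ} (ε : Fin n → ℝ) {G : Type*} [AddCommGroup G] {R : Type*}
    [Ring R] [Algebra ℝ R] (𝒜 : G → Submodule ℝ R) : Prop :=
  ∃ α : Fin n → G, IsElementaryBasis α ∧
    GradingIsomorphic 𝒜 (monomialGrading (anticommGen ε) α)

/-- The signs `-1` for the first `p` of `n` generators, `1` for the others. -/
noncomputable def firstNegative (n p : ℕ) (i : Fin n) : ℝ := if i.val < p then -1 else 1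

/-! ### Signs -/

/-! Everything is compared through even systems: an even number n of pairwise anticommuting elements
with nonzero real squares (`IsAnticommSystem`). Conjugation by the generators acts on monomials of
degree g in (ℤ/2)^n by signs, and for even n these signs determine g (`commDegree_injective`). Hence
monomials of different degrees are independent, the generated algebra has dimension 2^n, and for
squares ±1 the graded algebra depends only on the number of negative squares
(`equivalent_and_presentation_of_system`). Presented algebras, Clifford algebras and tensor products
of M_2 and ℍ are all generated by such systems, so identifying them is a count of signs.

For the classification, fineness enters through conjugation by a homogeneous y with y² a nonzero
scalar. It preserves components and squares to the identity; its eigenspaces would refine the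
grading, so y commutes or anticommutes with each whole component
(`commute_or_anticommute_of_isFineGrading`). If the identity component R_0 were larger than ℝ, it
would contain i with i² = -1, and then R_0 = ℝ + ℝi. As R is central, some homogeneous unit x
anticommutes with i. A norm argument shows that x² is central, hence real; then x must commute with
R_0, a contradiction (`degree_zero_eq_real`).

With R_0 = ℝ the components are lines, homogeneous units commute up to sign and have real squares,
so G has exponent 2. A system is now grown two generators at a time (`IsSignedSystem.exists_succ`):
a word ω anticommuting with the system turns an anticommuting pair a, b that commutes with it into
new generators ωa, ωb. The invariant is that 2k generators have k negative squares and ω² = 1, or k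
+ 1 negative squares and ω² = -1. It is preserved because a can be taken with a² = -1, and it leaves
exactly the two families. Growth stops since 2^(2k) ≤ dim R, and it stops only when the degrees span
G. -/

/-- The sign character of `ℤ/2`. -/
noncomputable def zmodSign (s : ZMod 2) : ℝ := if s = 0 then 1 else -1

lemma zmodSign_zero : zmodSign 0 = 1 := by simp [zmodSign]

lemma zmodSign_one : zmodSign 1 = -1 := by simp [zmodSign]

lemma zmod_two_cases (s : ZMod 2) : s = 0 ∨ s = 1 := by
  revert s; decide

lemma zmodSign_add (s t : ZMod 2) : zmodSign (s + t) = zmodSign s * zmodSign t := by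
  rcases zmod_two_cases s with rfl | rfl <;> rcases zmod_two_cases t with rfl | rfl <;>
    simp [zmodSign, show (1 : ZMod 2) + 1 = 0 from rfl]

lemma zmodSign_injective : Function.Injective zmodSign := by
  intro s t h
  rcases zmod_two_cases s with rfl | rfl <;> rcases zmod_two_cases t with rfl | rfl <;>
    first | rfl | (norm_num [zmodSign] at h)

lemma zmodSign_mul_self (s : ZMod 2) : zmodSign s * zmodSign s = 1 := by
  rcases zmod_two_cases s with rfl | rfl <;> norm_num [zmodSign]

lemma zmodSign_mul_of_ne {s t : ZMod 2} (h : s ≠ t) : zmodSign s * zmodSign t = -1 := by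
  rcases zmod_two_cases s with rfl | rfl <;> rcases zmod_two_cases t with rfl | rfl <;>
    first | exact absurd rfl h | norm_num [zmodSign]

/-! ### Independence by projections -/

/-- Submodules are independent if each has a linear map that is the identity on it and kills the
others. -/
lemma iSupIndep_of_projections {ι M : Type*} [AddCommGroup M] [Module ℝ M]
    (p : ι → Submodule ℝ M) (P : ι → M →ₗ[ℝ] M) (h1 : ∀ i, ∀ m ∈ p i, P i m = m)
    (h2 : ∀ i j, j ≠ i → ∀ m ∈ p j, P i m = 0) : iSupIndep p := by
  intro i
  rw [Submodule.disjoint_def]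
  intro m hm hm'
  have : (⨆ j, ⨆ (_ : j ≠ i), p j) ≤ LinearMap.ker (P i) :=
    iSup₂_le fun j hj m hm => h2 i j hj m hm
  rw [← h1 i m hm]
  exact this hm'

/-- Evaluates products of eigenprojections on a common eigenvector. -/
lemma list_prod_apply_of_eigenvector {κ M : Type*} [AddCommGroup M] [Module ℝ M]
    (f : κ → Module.End ℝ M) (c : κ → ℝ) (m : M) (h : ∀ j, f j m = c j • m) (l : List κ) :
    (l.map f).prod m = (l.map c).prod • m := by
  induction l with
  | nil => simp
  | cons a l ih => simp [ih, h, smul_smul, mul_comm]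

/-! ### Monomial gradings -/

section Monomial

variable {ι κ G H R S : Type*} [AddCommGroup G] [AddCommGroup H] [Ring R] [Algebra ℝ R]
  [Ring S] [Algebra ℝ S]

lemma prod_mem_monomialGrading (x : ι → R) (d : ι → G) (l : List ι) :
    (l.map x).prod ∈ monomialGrading x d (l.map d).sum :=
  Submodule.subset_span ⟨l, rfl, rfl⟩

lemma monomialGrading_map (φ : R →ₐ[ℝ] S) (x : ι → R) (d : ι → G) (g : G) :
    (monomialGrading x d g).map φ.toLinearMap = monomialGrading (φ ∘ x) d g := by
  rw [monomialGrading, Submodule.map_span, monomialGrading]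
  congr 1
  ext a
  constructor
  · rintro ⟨_, ⟨l, hl, rfl⟩, rfl⟩
    exact ⟨l, hl, by simp [map_list_prod]⟩
  · rintro ⟨l, hl, rfl⟩
    exact ⟨_, ⟨l, hl, rfl⟩, by simp [map_list_prod]⟩

lemma monomialGrading_degree_equiv (e : G ≃+ H) (x : ι → R) (d : ι → G) (g : G) :
    monomialGrading x (e ∘ d) (e g) = monomialGrading x d g := by
  have (l : List ι) : (l.map (e ∘ d)).sum = e (l.map d).sum := by
    rw [map_list_sum, List.map_map]
  simp only [monomialGrading, this, e.injective.eq_iff]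

lemma monomialGrading_reindex (e : κ ≃ ι) (x : ι → R) (d : ι → G) (g : G) :
    monomialGrading (x ∘ e) (d ∘ e) g = monomialGrading x d g := by
  rw [monomialGrading, monomialGrading]
  congr 1
  ext a
  constructor
  · rintro ⟨l, hl, rfl⟩
    exact ⟨l.map e, by simpa using hl, by simp⟩
  · rintro ⟨l, hl, rfl⟩
    refine ⟨l.map e.symm, ?_, ?_⟩
    · rw [List.map_map, Function.comp_assoc]; simpa using hl
    · rw [List.map_map, Function.comp_assoc]; simp

lemma monomialGrading_gradedMonoid (x : ι → R) (d : ι → G) :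
    SetLike.GradedMonoid (monomialGrading x d) where
  one_mem := by simpa using prod_mem_monomialGrading x d []
  mul_mem := by
    intro g h a b ha hb
    have : monomialGrading x d g * monomialGrading x d h ≤ monomialGrading x d (g + h) := by
      rw [monomialGrading, monomialGrading, Submodule.span_mul_span, Submodule.span_le]
      rintro _ ⟨_, ⟨l, hl, rfl⟩, _, ⟨l', hl', rfl⟩, rfl⟩
      exact Submodule.subset_span ⟨l ++ l', by simp [hl, hl'], by simp⟩
    exact this (Submodule.mul_mem_mul ha hb)

lemma iSup_monomialGrading (x : ι → R) (d : ι → G)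
    (hx : Algebra.adjoin ℝ (Set.range x) = ⊤) : ⨆ g, monomialGrading x d g = ⊤ := by
  rw [eq_top_iff, ← Algebra.top_toSubmodule, ← hx, Algebra.adjoin_eq_span, Submodule.span_le]
  intro a ha
  obtain ⟨l, rfl⟩ : ∃ l : List ι, a = (l.map x).prod := by
    induction ha using Submonoid.closure_induction with
    | mem a ha => obtain ⟨i, rfl⟩ := ha; exact ⟨[i], by simp⟩
    | one => exact ⟨[], by simp⟩
    | mul a b _ _ ha hb =>
      obtain ⟨l, rfl⟩ := ha
      obtain ⟨l', rfl⟩ := hb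
      exact ⟨l ++ l', by simp⟩
  exact (le_iSup (monomialGrading x d) _) (prod_mem_monomialGrading x d l)

end Monomial

/-! ### Systems of anticommuting elements -/

/-- Pairwise anticommuting elements with prescribed nonzero real squares. -/
structure IsAnticommSystem {ι R : Type*} [Ring R] [Algebra ℝ R] (ε : ι → ℝ) (x : ι → R) :
    Prop where
  sq : ∀ i, x i * x i = algebraMap ℝ R (ε i)
  anticomm : ∀ i j, i ≠ j → x i * x j = -(x j * x i)
  ne_zero : ∀ i, ε i ≠ 0

/-- The degree of a word in the elementary abelian 2-group generated by its letters. -/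
def wordDegree {ι : Type*} [DecidableEq ι] (l : List ι) : ι → ZMod 2 :=
  (l.map fun i => Pi.single i (1 : ZMod 2)).sum

section WordDegree

variable {ι : Type*} [DecidableEq ι]

lemma wordDegree_append (l l' : List ι) :
    wordDegree (l ++ l') = wordDegree l + wordDegree l' := by simp [wordDegree]

lemma wordDegree_reverse (l : List ι) : wordDegree l.reverse = wordDegree l := by
  rw [wordDegree, List.map_reverse, List.sum_reverse, wordDegree]

lemma wordDegree_perm {l l' : List ι} (h : l.Perm l') : wordDegree l = wordDegree l' :=
  (h.map _).sum_eq

lemma exists_wordDegree_eq [Fintype ι] (g : ι → ZMod 2) : ∃ l : List ι, wordDegree l = g := by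
  rw [← Finset.univ_sum_single g]
  refine Finset.sum_induction _ (fun g => ∃ l : List ι, wordDegree l = g) ?_ ⟨[], rfl⟩ ?_
  · rintro _ _ ⟨l, rfl⟩ ⟨l', rfl⟩
    exact ⟨l ++ l', wordDegree_append l l'⟩
  · intro i _
    rcases zmod_two_cases (g i) with h | h
    · exact ⟨[], by simp [h, wordDegree]⟩
    · exact ⟨[i], by simp [h, wordDegree]⟩

lemma add_self_eq_zero_zmod_two {α : Type*} (g : α → ZMod 2) : g + g = 0 := by
  funext i
  exact CharTwo.add_self_eq_zero (g i)

/-- The coordinate of the degree at a letter counts its occurrences mod 2, so degree zero forces the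
head to occur again. -/
lemma wordDegree_eq_zero_mem {a : ι} {l : List ι} (h : wordDegree (a :: l) = 0) : a ∈ l := by
  by_contra ha
  have h1 : ∀ l : List ι, a ∉ l → wordDegree l a = 0 := by
    intro l hl
    induction l with
    | nil => rfl
    | cons b l ih =>
      simp only [List.mem_cons, not_or] at hl
      have := ih hl.2
      simp only [wordDegree, List.map_cons, List.sum_cons, Pi.add_apply] at this ⊢
      rw [this, Pi.single_eq_of_ne hl.1, add_zero]
  have h2 := congrFun h a
  have h3 := h1 l ha
  simp only [wordDegree, List.map_cons, List.sum_cons, Pi.add_apply, Pi.single_eq_same,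
    Pi.zero_apply] at h2 h3
  rw [h3] at h2
  exact absurd h2 (by decide)

/-- The commutation character: whether the `j`-th generator anticommutes with words of degree
`g`. -/
def commDegree {ι : Type*} [Fintype ι] (g : ι → ZMod 2) (j : ι) : ZMod 2 := (∑ i, g i) + g j

lemma commDegree_add {ι : Type*} [Fintype ι] (g h : ι → ZMod 2) :
    commDegree (g + h) = commDegree g + commDegree h := by
  funext j
  simp only [commDegree, Pi.add_apply, Finset.sum_add_distrib]
  ring

/-- A vector in the kernel is constant, equal to its own coordinate sum, and over an even index set
this sum vanishes mod 2. For odd cardinality the all-ones vector lies in the kernel: the product of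
all generators is then central. -/
lemma commDegree_injective {ι : Type*} [Fintype ι] (hι : Even (Fintype.card ι)) :
    Function.Injective (commDegree : (ι → ZMod 2) → ι → ZMod 2) := by
  let F : (ι → ZMod 2) →+ (ι → ZMod 2) :=
    ⟨⟨commDegree, by funext j; simp [commDegree]⟩, commDegree_add⟩
  refine (injective_iff_map_eq_zero F).2 fun g hg => ?_
  have h1 : ∀ j, g j = ∑ i, g i := by
    intro j
    have := congrFun hg j
    change (∑ i, g i) + g j = 0 at this
    exact ((CharTwo.add_eq_zero).1 this).symm
  have h2 : ∑ i, g i = 0 := by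
    rw [Finset.sum_congr rfl fun i _ => h1 i, Finset.sum_const, Finset.card_univ]
    obtain ⟨m, hm⟩ := hι
    rw [hm, add_smul]
    exact CharTwo.add_self_eq_zero _
  funext j
  rw [h1 j, h2]; rfl

lemma commDegree_surjective {ι : Type*} [Fintype ι] (hι : Even (Fintype.card ι)) :
    Function.Surjective (commDegree : (ι → ZMod 2) → ι → ZMod 2) :=
  Finite.surjective_of_injective (commDegree_injective hι)

end WordDegree

namespace IsAnticommSystem

variable {ι κ R S : Type*} [Ring R] [Algebra ℝ R] [Ring S] [Algebra ℝ S] {ε : ι → ℝ} {x : ι → R}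

lemma comp_injective (h : IsAnticommSystem ε x) (e : κ → ι) (he : Function.Injective e) :
    IsAnticommSystem (ε ∘ e) (x ∘ e) :=
  ⟨fun _ => h.sq _, fun _ _ hij => h.anticomm _ _ (he.ne hij), fun _ => h.ne_zero _⟩

lemma map (h : IsAnticommSystem ε x) (φ : R →ₐ[ℝ] S) : IsAnticommSystem ε (φ ∘ x) :=
  ⟨fun i => by simp [← map_mul, h.sq], fun i j hij => by
    simp only [Function.comp_apply, ← map_mul, ← map_neg, h.anticomm i j hij], h.ne_zero⟩

lemma isUnit (h : IsAnticommSystem ε x) (i : ι) : IsUnit (x i) := by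
  have h1 : IsUnit (x i * x i) := by
    rw [h.sq]; exact (IsUnit.mk0 _ (h.ne_zero i)).map (algebraMap ℝ R)
  exact ((Commute.refl (x i)).isUnit_mul_iff.1 h1).1

lemma isUnit_prod (h : IsAnticommSystem ε x) (l : List ι) : IsUnit (l.map x).prod := by
  induction l with
  | nil => simp
  | cons a l ih => simpa using (h.isUnit a).mul ih

lemma prod_perm (h : IsAnticommSystem ε x) {l l' : List ι} (hl : l.Perm l') :
    ∃ c : ℝ, c ≠ 0 ∧ (l.map x).prod = c • (l'.map x).prod := by
  induction hl with
  | nil => exact ⟨1, one_ne_zero, by simp⟩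
  | cons a _ ih =>
    obtain ⟨c, hc, hc'⟩ := ih
    exact ⟨c, hc, by simp [hc']⟩
  | swap a b l =>
    by_cases hab : b = a
    · exact ⟨1, one_ne_zero, by simp [hab]⟩
    · refine ⟨-1, by norm_num, ?_⟩
      simp only [List.map_cons, List.prod_cons, ← mul_assoc]
      rw [h.anticomm b a hab]; simp
  | trans _ _ ih1 ih2 =>
    obtain ⟨c, hc, hc'⟩ := ih1
    obtain ⟨d, hd, hd'⟩ := ih2
    exact ⟨c * d, mul_ne_zero hc hd, by rw [hc', hd', smul_smul]⟩

variable [DecidableEq ι]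

/-- Some later letter repeats the head; moving it next to the head costs a scalar and produces a
square, which is real. Induction on the length finishes. -/
lemma prod_of_wordDegree_eq_zero (h : IsAnticommSystem ε x) (l : List ι)
    (hl : wordDegree l = 0) : ∃ c : ℝ, c ≠ 0 ∧ (l.map x).prod = algebraMap ℝ R c := by
  induction hn : l.length using Nat.strong_induction_on generalizing l with
  | _ n ih =>
    match l, hl, hn with
    | [], _, _ => exact ⟨1, one_ne_zero, by simp⟩
    | a :: t, hl, hn =>
      have hat := wordDegree_eq_zero_mem hl
      have hp : (a :: t).Perm (a :: a :: t.erase a) := (List.perm_cons_erase hat).cons a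
      have hd : wordDegree (t.erase a) = 0 := by
        rw [wordDegree_perm hp, show a :: a :: t.erase a = [a] ++ ([a] ++ t.erase a) from rfl,
          wordDegree_append, wordDegree_append, ← add_assoc, add_self_eq_zero_zmod_two,
          zero_add] at hl
        exact hl
      obtain ⟨c, hc, hc'⟩ := h.prod_perm hp
      obtain ⟨d, hd, hd'⟩ := ih (t.erase a).length (by
        have := List.length_erase_of_mem hat
        have := List.length_pos_of_mem hat
        simp only [List.length_cons] at hn
        omega) _ hd rfl
      refine ⟨c * (ε a * d), mul_ne_zero hc (mul_ne_zero (h.ne_zero a) hd), ?_⟩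
      rw [hc', List.map_cons, List.prod_cons, List.map_cons, List.prod_cons, hd', ← mul_assoc,
        h.sq, Algebra.smul_def, ← map_mul, ← map_mul]

lemma prod_of_wordDegree_eq (h : IsAnticommSystem ε x) {l l' : List ι}
    (hl : wordDegree l = wordDegree l') :
    ∃ c : ℝ, c ≠ 0 ∧ (l.map x).prod = c • (l'.map x).prod := by
  obtain ⟨c, hc, hc'⟩ := h.prod_of_wordDegree_eq_zero (l ++ l'.reverse) (by
    rw [wordDegree_append, wordDegree_reverse, hl, add_self_eq_zero_zmod_two])
  obtain ⟨d, hd, hd'⟩ := h.prod_of_wordDegree_eq_zero (l' ++ l'.reverse) (by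
    rw [wordDegree_append, wordDegree_reverse, add_self_eq_zero_zmod_two])
  -- Right multiplication by the reversed second word turns the two words into the scalars c and d;
  -- that word is a unit and cancels.
  refine ⟨c / d, div_ne_zero hc hd, (h.isUnit_prod l'.reverse).mul_left_injective ?_⟩
  simp only [List.map_append, List.prod_append] at hc' hd'
  change _ * _ = (c / d) • _ * _
  rw [hc', smul_mul_assoc, hd', Algebra.smul_def, ← map_mul, div_mul_cancel₀ c hd]

/-- Passing `x j` through a word costs a sign for each letter other than j: the length minus the
number of occurrences of j, mod 2. -/
lemma mul_prod [Fintype ι] (h : IsAnticommSystem ε x) (j : ι) (l : List ι) :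
    x j * (l.map x).prod = zmodSign (commDegree (wordDegree l) j) • ((l.map x).prod * x j) := by
  induction l with
  | nil => simp [wordDegree, commDegree, zmodSign]
  | cons a l ih =>
    have h1 : x j * x a = zmodSign (commDegree (wordDegree [a]) j) • (x a * x j) := by
      by_cases hj : j = a
      · subst hj
        simp [wordDegree, commDegree, zmodSign, show (1 : ZMod 2) + 1 = 0 from rfl]
      · simp [wordDegree, commDegree, zmodSign, h.anticomm j a hj, Pi.single_eq_of_ne hj]
    rw [show a :: l = [a] ++ l from rfl, wordDegree_append, commDegree_add, Pi.add_apply,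
      zmodSign_add]
    simp only [List.map_append, List.map_cons, List.map_nil, List.prod_append, List.prod_cons,
      List.prod_nil, mul_one]
    rw [← mul_assoc, h1, smul_mul_assoc, mul_assoc, ih, mul_smul_comm, smul_smul, mul_assoc]

end IsAnticommSystem

/-- The monomial grading in which the degrees of the generators are the standard basis vectors. -/
noncomputable abbrev standardGrading {ι R : Type*} [DecidableEq ι] [Ring R] [Algebra ℝ R]
    (x : ι → R) : (ι → ZMod 2) → Submodule ℝ R :=
  monomialGrading x (fun i => Pi.single i 1)

namespace IsAnticommSystem

variable {ι κ R S : Type*} [Ring R] [Algebra ℝ R] [Ring S] [Algebra ℝ S] {ε : ι → ℝ} {x : ι → R}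
  [DecidableEq ι]

lemma standardGrading_wordDegree (h : IsAnticommSystem ε x) (l : List ι) :
    standardGrading x (wordDegree l) = Submodule.span ℝ {(l.map x).prod} := by
  refine le_antisymm (Submodule.span_le.2 ?_)
    ((Submodule.span_singleton_le_iff_mem _ _).2 (prod_mem_monomialGrading x _ l))
  rintro _ ⟨l', hl', rfl⟩
  obtain ⟨c, -, hc⟩ := h.prod_of_wordDegree_eq (l := l') (l' := l) hl'
  rw [hc]
  exact Submodule.smul_mem _ _ (Submodule.mem_span_singleton_self _)

lemma isDivisionGrading [Fintype ι] (h : IsAnticommSystem ε x) :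
    IsDivisionGrading (standardGrading x) := by
  intro g a ha ha0
  obtain ⟨l, rfl⟩ := exists_wordDegree_eq g
  rw [h.standardGrading_wordDegree, Submodule.mem_span_singleton] at ha
  obtain ⟨c, rfl⟩ := ha
  have hc : c ≠ 0 := by rintro rfl; simp at ha0
  rw [Algebra.smul_def]
  exact ((IsUnit.mk0 _ hc).map (algebraMap ℝ R)).mul (h.isUnit_prod l)

lemma finrank_standardGrading [Fintype ι] [Nontrivial R] (h : IsAnticommSystem ε x)
    (g : ι → ZMod 2) : Module.finrank ℝ (standardGrading x g) = 1 := by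
  obtain ⟨l, rfl⟩ := exists_wordDegree_eq g
  rw [h.standardGrading_wordDegree]
  exact finrank_span_singleton (h.isUnit_prod l).ne_zero

lemma mul_of_mem [Fintype ι] (h : IsAnticommSystem ε x) {g : ι → ZMod 2} {a : R}
    (ha : a ∈ standardGrading x g) (j : ι) :
    x j * a = zmodSign (commDegree g j) • (a * x j) := by
  obtain ⟨l, rfl⟩ := exists_wordDegree_eq g
  rw [h.standardGrading_wordDegree, Submodule.mem_span_singleton] at ha
  obtain ⟨c, rfl⟩ := ha
  rw [mul_smul_comm, h.mul_prod, smul_mul_assoc, smul_comm]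

/-- The components are joint eigenspaces of the conjugations by the generators, and in even rank
different degrees give different sign patterns. -/
lemma iSupIndep_standardGrading [Fintype ι] (h : IsAnticommSystem ε x)
    (hι : Even (Fintype.card ι)) : iSupIndep (standardGrading x) := by
  -- Conjugation by `x j`, whose inverse is `(ε j)⁻¹ • x j`.
  let f : ι → Module.End ℝ R := fun j =>
    LinearMap.mulLeft ℝ (x j) ∘ₗ LinearMap.mulRight ℝ ((ε j)⁻¹ • x j)
  have hf : ∀ g, ∀ a ∈ standardGrading x g, ∀ j, f j a = zmodSign (commDegree g j) • a := by
    intro g a ha j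
    simp only [f, LinearMap.comp_apply, LinearMap.mulLeft_apply, LinearMap.mulRight_apply]
    rw [← mul_assoc, h.mul_of_mem ha, mul_smul_comm, smul_mul_assoc, mul_assoc, h.sq,
      ← Algebra.commutes, ← Algebra.smul_def, smul_smul, smul_smul]
    congr 1
    field_simp [h.ne_zero j]
  -- Product of the eigenprojections for the signs of g. On another component the factor at an index
  -- where the signs differ vanishes.
  let P : (ι → ZMod 2) → Module.End ℝ R := fun g =>
    ((Finset.univ.toList : List ι).map fun j =>
      (2 : ℝ)⁻¹ • (1 + zmodSign (commDegree g j) • f j)).prod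
  have hP : ∀ g g', ∀ a ∈ standardGrading x g', P g a =
      ((Finset.univ.toList : List ι).map fun j =>
        (2 : ℝ)⁻¹ * (1 + zmodSign (commDegree g j) * zmodSign (commDegree g' j))).prod • a := by
    intro g g' a ha
    refine list_prod_apply_of_eigenvector _ _ _ (fun j => ?_) _
    change (2 : ℝ)⁻¹ • (a + zmodSign (commDegree g j) • f j a) = _
    rw [hf g' a ha j, mul_smul, add_smul, one_smul, mul_smul]
  refine iSupIndep_of_projections _ P ?_ ?_
  · intro g a ha
    rw [hP g g a ha, List.prod_eq_one, one_smul]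
    intro c hc
    obtain ⟨j, -, rfl⟩ := List.mem_map.1 hc
    rw [zmodSign_mul_self]; norm_num
  · intro g g' hne a ha
    rw [hP g g' a ha, List.prod_eq_zero, zero_smul]
    obtain ⟨j, hj⟩ := Function.ne_iff.1 ((commDegree_injective hι).ne hne)
    refine List.mem_map.2 ⟨j, by simp, ?_⟩
    rw [zmodSign_mul_of_ne hj.symm]; norm_num

lemma isInternal [Fintype ι] (h : IsAnticommSystem ε x) (hι : Even (Fintype.card ι))
    (hx : Algebra.adjoin ℝ (Set.range x) = ⊤) : DirectSum.IsInternal (standardGrading x) :=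
  DirectSum.isInternal_submodule_of_iSupIndep_of_iSup_eq_top (h.iSupIndep_standardGrading hι)
    (iSup_monomialGrading x _ hx)

lemma nonempty_gradedAlgebra [Fintype ι] (h : IsAnticommSystem ε x)
    (hι : Even (Fintype.card ι)) (hx : Algebra.adjoin ℝ (Set.range x) = ⊤) :
    Nonempty (GradedAlgebra (standardGrading x)) :=
  ⟨{ monomialGrading_gradedMonoid x _, (h.isInternal hι hx).chooseDecomposition _ with }⟩

section Dimension

variable [Fintype ι] [Nontrivial R]

lemma exists_linearIndependent (h : IsAnticommSystem ε x) (hι : Even (Fintype.card ι)) :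
    ∃ v : (ι → ZMod 2) → R, LinearIndependent ℝ v ∧
    ∀ g, standardGrading x g = Submodule.span ℝ {v g} := by
  choose w hw using exists_wordDegree_eq (ι := ι)
  have hs : ∀ g, standardGrading x g = Submodule.span ℝ {((w g).map x).prod} := fun g => by
    conv_lhs => rw [← hw g]
    exact h.standardGrading_wordDegree (w g)
  refine ⟨fun g => ((w g).map x).prod, ?_, hs⟩
  refine (h.iSupIndep_standardGrading hι).linearIndependent (standardGrading x) ?_ ?_
  · intro g
    rw [hs]
    exact Submodule.mem_span_singleton_self _
  · intro g
    exact (h.isUnit_prod _).ne_zero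

/-- This bound on the number of generators ends the inductive construction of systems. -/
lemma pow_card_le_finrank [FiniteDimensional ℝ R] (h : IsAnticommSystem ε x) (hι : Even (Fintype.card ι)) :
    2 ^ Fintype.card ι ≤ Module.finrank ℝ R := by
  obtain ⟨v, hv, -⟩ := h.exists_linearIndependent hι
  simpa using hv.fintype_card_le_finrank

lemma finrank_eq (h : IsAnticommSystem ε x) (hι : Even (Fintype.card ι))
    (hx : Algebra.adjoin ℝ (Set.range x) = ⊤) :
    FiniteDimensional ℝ R ∧ Module.finrank ℝ R = 2 ^ Fintype.card ι := by
  obtain ⟨v, hv, hv'⟩ := h.exists_linearIndependent hι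
  have hsp : ⊤ ≤ Submodule.span ℝ (Set.range v) := by
    rw [← iSup_monomialGrading x (fun i => Pi.single i (1 : ZMod 2)) hx]
    refine iSup_le fun g => ?_
    exact (hv' g).le.trans (Submodule.span_mono (by simp))
  let b := Module.Basis.mk hv hsp
  exact ⟨b.finiteDimensional_of_finite, by simp [Module.finrank_eq_card_basis b]⟩

lemma adjoin_eq_top [FiniteDimensional ℝ R] (h : IsAnticommSystem ε x) (hι : Even (Fintype.card ι))
    (hd : Module.finrank ℝ R = 2 ^ Fintype.card ι) : Algebra.adjoin ℝ (Set.range x) = ⊤ := by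
  obtain ⟨v, hv, hv'⟩ := h.exists_linearIndependent hι
  have h1 := hv.span_eq_top_of_card_eq_finrank' (by simp [hd])
  rw [eq_top_iff]
  change Subalgebra.toSubmodule ⊤ ≤ Subalgebra.toSubmodule (Algebra.adjoin ℝ (Set.range x))
  rw [Algebra.top_toSubmodule, ← h1, Submodule.span_le]
  rintro _ ⟨g, rfl⟩
  have h2 : standardGrading x g ≤ Subalgebra.toSubmodule (Algebra.adjoin ℝ (Set.range x)) := by
    refine Submodule.span_le.2 ?_
    rintro _ ⟨l, -, rfl⟩
    refine list_prod_mem (S := Algebra.adjoin ℝ (Set.range x)) fun a ha => ?_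
    obtain ⟨i, -, rfl⟩ := List.mem_map.1 ha
    exact Algebra.subset_adjoin ⟨i, rfl⟩
  exact h2 (hv' g ▸ Submodule.mem_span_singleton_self _)

end Dimension

end IsAnticommSystem

/-- A grading with one-dimensional nonzero components is fine. -/
lemma isFineGrading_of_finrank_eq_one {G : Type u} {R : Type v} [Ring R] [Algebra ℝ R]
    (𝒜 : G → Submodule ℝ R) (h : ∀ g, Module.finrank ℝ (𝒜 g) = 1) : IsFineGrading 𝒜 := by
  rintro H _ _ ℬ _ ⟨-, k, hk, g, hg⟩
  have := Module.finite_of_finrank_pos (R := ℝ) (M := 𝒜 g) (by rw [h]; norm_num)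
  have h1 := Submodule.finrank_lt_finrank_of_lt hg
  rw [h, Nat.lt_one_iff] at h1
  have := Submodule.finiteDimensional_of_le hg.le
  exact hk (Submodule.finrank_eq_zero.1 h1)

/-! ### The presented algebra and comparison of systems -/

section Presentation

variable {n : ℕ} {ε : Fin n → ℝ}

lemma isAnticommSystem_anticommGen (hε : ∀ i, ε i ≠ 0) :
    IsAnticommSystem ε (anticommGen ε) where
  sq i := by
    simp only [anticommGen, ← map_mul]
    rw [RingQuot.mkAlgHom_rel ℝ (AnticommRel.sq i), AlgHom.commutes]
  anticomm i j hij := by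
    have key : ∀ s t : Fin n, s < t →
        anticommGen ε s * anticommGen ε t = -(anticommGen ε t * anticommGen ε s) := by
      intro s t hst
      simp only [anticommGen, ← map_mul, ← map_neg]
      exact RingQuot.mkAlgHom_rel ℝ (AnticommRel.anticomm s t hst)
    rcases lt_or_gt_of_ne hij with h | h
    · exact key i j h
    · rw [key j i h, neg_neg]
  ne_zero := hε

lemma adjoin_anticommGen : Algebra.adjoin ℝ (Set.range (anticommGen ε)) = ⊤ := by
  have : Set.range (anticommGen ε) =
      RingQuot.mkAlgHom ℝ (AnticommRel ε) '' Set.range (FreeAlgebra.ι ℝ) := by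
    rw [← Set.range_comp]; rfl
  rw [this, ← AlgHom.map_adjoin, FreeAlgebra.adjoin_range_ι, Algebra.map_top,
    AlgHom.range_eq_top]
  exact RingQuot.mkAlgHom_surjective ℝ _

variable {R : Type*} [Ring R] [Algebra ℝ R]

/-- The algebra map from the presented algebra given by a system of anticommuting elements. -/
noncomputable def IsAnticommSystem.lift {x : Fin n → R} (h : IsAnticommSystem ε x) :
    AnticommAlgebra ε →ₐ[ℝ] R :=
  RingQuot.liftAlgHom ℝ ⟨FreeAlgebra.lift ℝ x, by
    rintro _ _ (i | ⟨s, t, hst⟩)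
    · simp [h.sq]
    · simp [h.anticomm s t hst.ne]⟩

lemma IsAnticommSystem.lift_anticommGen {x : Fin n → R} (h : IsAnticommSystem ε x) (i : Fin n) :
    h.lift (anticommGen ε i) = x i := by
  simp [lift, anticommGen]

/-- The canonical map is onto, and both sides have dimension 2^n because each is generated by a
system. The presented algebra is nonzero since it maps to R. -/
lemma IsAnticommSystem.exists_algEquiv_anticommAlgebra [Nontrivial R] {x : Fin n → R}
    (h : IsAnticommSystem ε x) (hn : Even n) (hx : Algebra.adjoin ℝ (Set.range x) = ⊤) :
    ∃ φ : AnticommAlgebra ε ≃ₐ[ℝ] R, ∀ i, φ (anticommGen ε i) = x i := by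
  have : Nontrivial (AnticommAlgebra ε) := h.lift.toRingHom.domain_nontrivial
  have hn' : Even (Fintype.card (Fin n)) := by simpa using hn
  obtain ⟨h1, h2⟩ := (isAnticommSystem_anticommGen h.ne_zero).finrank_eq hn' adjoin_anticommGen
  obtain ⟨h3, h4⟩ := h.finrank_eq hn' hx
  have hs : Function.Surjective h.lift := by
    rw [← AlgHom.range_eq_top, eq_top_iff, ← hx]
    refine Algebra.adjoin_le ?_
    rintro _ ⟨i, rfl⟩
    exact ⟨_, h.lift_anticommGen i⟩
  have hi : Function.Injective h.lift :=
    (LinearMap.injective_iff_surjective_of_finrank_eq_finrank (f := h.lift.toLinearMap)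
      (h2.trans h4.symm)).2 hs
  exact ⟨AlgEquiv.ofBijective h.lift ⟨hi, hs⟩, h.lift_anticommGen⟩

/-- Two algebras generated by systems of anticommuting elements with the same squares are
isomorphic. -/
lemma IsAnticommSystem.exists_algEquiv {ι κ S : Type*} [Ring S] [Algebra ℝ S] [Nontrivial R]
    [Nontrivial S] [Fintype ι] {ε : ι → ℝ} {δ : κ → ℝ} {x : ι → R} {y : κ → S}
    (h : IsAnticommSystem ε x) (h' : IsAnticommSystem δ y) (hι : Even (Fintype.card ι))
    (hx : Algebra.adjoin ℝ (Set.range x) = ⊤) (hy : Algebra.adjoin ℝ (Set.range y) = ⊤)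
    (e : ι ≃ κ) (he : ∀ i, δ (e i) = ε i) : ∃ φ : R ≃ₐ[ℝ] S, ∀ i, φ (x i) = y (e i) := by
  -- Both algebras are compared with one presented algebra, which is indexed by `Fin`.
  let f := (Fintype.equivFin ι).symm
  have hh := h.comp_injective f f.injective
  have hh' := h'.comp_injective (e ∘ f) (e.injective.comp f.injective)
  rw [show δ ∘ e ∘ f = ε ∘ f from funext fun i => he _] at hh'
  obtain ⟨φ, hφ⟩ := hh.exists_algEquiv_anticommAlgebra hι (by
    rwa [f.surjective.range_comp])
  obtain ⟨ψ, hψ⟩ := hh'.exists_algEquiv_anticommAlgebra hι (by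
    rwa [(e.surjective.comp f.surjective).range_comp])
  refine ⟨φ.symm.trans ψ, fun i => ?_⟩
  obtain ⟨j, rfl⟩ := f.surjective i
  have : φ.symm (x (f j)) = anticommGen _ j := by
    rw [AlgEquiv.symm_apply_eq, hφ]; rfl
  rw [AlgEquiv.trans_apply, this, hψ]; rfl

end Presentation

/-! ### Gradings with components of dimension at most one -/

section Degrees

variable {ι κ G : Type*} [AddCommGroup G] {R S : Type*} [Ring R] [Algebra ℝ R]
  [Ring S] [Algebra ℝ S]

lemma isElementaryBasis_single {n : ℕ} [Finite κ] [DecidableEq κ] (e : Fin n ≃ κ) :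
    IsElementaryBasis (fun i => (Pi.single (e i) 1 : κ → ZMod 2)) :=
  ⟨inferInstance, (Pi.basisFun (ZMod 2) κ).reindex e.symm, fun i => by simp⟩

lemma IsElementaryBasis.map_addEquiv {n : ℕ} {H : Type*} [AddCommGroup H] {α : Fin n → G}
    (h : IsElementaryBasis α) (e : G ≃+ H) : IsElementaryBasis (e ∘ α) := by
  obtain ⟨_, b, hb⟩ := h
  let _ : Module (ZMod 2) H := e.symm.module (ZMod 2)
  let e' : G ≃ₗ[ZMod 2] H :=
    { e with
      map_smul' := fun c g => by
        change e (c • g) = e (c • e.symm (e g))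
        simp }
  exact ⟨inferInstance, b.map e', fun i => by simp [hb]; rfl⟩

/-- A generating system whose degrees span the group of a grading with one-dimensional components
gives back the grading, and the degrees form a basis of the group. -/
lemma IsAnticommSystem.exists_addEquiv [Fintype ι] [DecidableEq ι] [Nontrivial R] {ε : ι → ℝ}
    {x : ι → R} (h : IsAnticommSystem ε x) (hι : Even (Fintype.card ι))
    (𝒜 : G → Submodule ℝ R) [SetLike.GradedMonoid 𝒜] (hG : ∀ g : G, g + g = 0)
    (h1 : ∀ g, ∃ a, 𝒜 g = Submodule.span ℝ {a}) (htop : ⨆ g, 𝒜 g = ⊤)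
    (α : ι → G) (hα : ∀ i, x i ∈ 𝒜 (α i))
    (hs : ∀ g, ∃ l : List ι, (l.map α).sum = g) :
    Algebra.adjoin ℝ (Set.range x) = ⊤ ∧
    ∃ e : (ι → ZMod 2) ≃+ G, (∀ i, e (Pi.single i 1) = α i) ∧
      ∀ g, standardGrading x g = 𝒜 (e g) := by
  let _ : Module (ZMod 2) G := AddCommGroup.zmodModule (n := 2) fun g => by rw [two_nsmul, hG]
  have hprod : ∀ l : List ι, (l.map x).prod ∈ 𝒜 (l.map α).sum := fun l =>
    SetLike.list_prod_map_mem_graded l α x fun i _ => hα i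
  let F : (ι → ZMod 2) →ₗ[ZMod 2] G := Fintype.linearCombination (ZMod 2) α
  have hF1 : ∀ i, F (Pi.single i 1) = α i := fun i => by simp [F]
  have hF : ∀ l : List ι, F (wordDegree l) = (l.map α).sum := fun l => by
    rw [wordDegree, map_list_sum, List.map_map]
    congr 2
    funext i
    exact hF1 i
  have hline : ∀ l : List ι, 𝒜 (l.map α).sum = Submodule.span ℝ {(l.map x).prod} := fun l => by
    obtain ⟨a, ha⟩ := h1 (l.map α).sum
    have h2 := hprod l
    rw [ha] at h2 ⊢
    obtain ⟨c, hc⟩ := Submodule.mem_span_singleton.1 h2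
    have hc0 : c ≠ 0 := by
      rintro rfl
      exact (h.isUnit_prod l).ne_zero (by rw [← hc, zero_smul])
    rw [← hc, Submodule.span_singleton_smul_eq (IsUnit.mk0 c hc0)]
  -- A word of degree zero in G lies in the line of 1, so it commutes with all generators. Its
  -- commutation character is therefore trivial, and in even rank so is its degree in (ℤ/2)^ι.
  have hinj : Function.Injective F := by
    refine (injective_iff_map_eq_zero F).2 fun g hg => ?_
    obtain ⟨l, rfl⟩ := exists_wordDegree_eq g
    have h0 := hline []
    have h2 := hprod l
    rw [← hF, hg] at h2
    simp only [List.map_nil, List.sum_nil, List.prod_nil] at h0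
    rw [h0] at h2
    obtain ⟨c, hc⟩ := Submodule.mem_span_singleton.1 h2
    refine commDegree_injective hι (funext fun j => zmodSign_injective ?_)
    have h3 := h.mul_prod j l
    have hu : IsUnit ((l.map x).prod * x j) := (h.isUnit_prod l).mul (h.isUnit j)
    have h4 : x j * (l.map x).prod = (1 : ℝ) • ((l.map x).prod * x j) := by
      rw [← hc]; simp
    rw [h4] at h3
    have h5 := smul_left_injective ℝ hu.ne_zero h3
    rw [← h5]; simp [commDegree, zmodSign]
  have hsurj : Function.Surjective F := fun g => by
    obtain ⟨l, hl⟩ := hs g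
    exact ⟨wordDegree l, by rw [hF, hl]⟩
  refine ⟨?_, AddEquiv.ofBijective F ⟨hinj, hsurj⟩, hF1, fun g => ?_⟩
  · rw [eq_top_iff]
    change Subalgebra.toSubmodule ⊤ ≤ Subalgebra.toSubmodule (Algebra.adjoin ℝ (Set.range x))
    rw [Algebra.top_toSubmodule, ← htop]
    refine iSup_le fun g => ?_
    obtain ⟨l, rfl⟩ := hs g
    rw [hline, Submodule.span_singleton_le_iff_mem]
    refine list_prod_mem (S := Algebra.adjoin ℝ (Set.range x)) fun a ha => ?_
    obtain ⟨i, -, rfl⟩ := List.mem_map.1 ha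
    exact Algebra.subset_adjoin ⟨i, rfl⟩
  · obtain ⟨l, rfl⟩ := exists_wordDegree_eq g
    rw [h.standardGrading_wordDegree, ← hline, ← hF]; rfl

/-- Gradings that both come from generating systems with the same squares are equivalent. -/
lemma gradingEquivalent_of_systems {H : Type*} [AddCommGroup H] [Nontrivial R] [Nontrivial S]
    [Fintype ι] [DecidableEq ι] [DecidableEq κ]
    {ε : ι → ℝ} {δ : κ → ℝ} {x : ι → R} {y : κ → S}
    (h : IsAnticommSystem ε x) (h' : IsAnticommSystem δ y) (hι : Even (Fintype.card ι))
    (hx : Algebra.adjoin ℝ (Set.range x) = ⊤) (hy : Algebra.adjoin ℝ (Set.range y) = ⊤)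
    (e : ι ≃ κ) (he : ∀ i, δ (e i) = ε i) (𝒜 : G → Submodule ℝ R) (ℬ : H → Submodule ℝ S)
    (a : (ι → ZMod 2) ≃+ G) (ha : ∀ g, standardGrading x g = 𝒜 (a g))
    (b : (κ → ZMod 2) ≃+ H) (hb : ∀ g, standardGrading y g = ℬ (b g)) :
    GradingEquivalent 𝒜 ℬ := by
  obtain ⟨φ, hφ⟩ := h.exists_algEquiv h' hι hx hy e he
  let E : (ι → ZMod 2) ≃+ (κ → ZMod 2) :=
    { Equiv.arrowCongr e (Equiv.refl _) with map_add' := fun _ _ => rfl }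
  have hE : ∀ i, E (Pi.single i 1) = Pi.single (e i) 1 := by
    intro i
    funext j
    change (Pi.single i 1 : ι → ZMod 2) (e.symm j) = _
    simp [Pi.single_apply, Equiv.symm_apply_eq]
  have key : ∀ g, (standardGrading x g).map φ.toLinearMap = standardGrading y (E g) := by
    intro g
    have h1 := monomialGrading_map φ.toAlgHom x (fun i => Pi.single i (1 : ZMod 2)) g
    have h2 : φ.toAlgHom ∘ x = y ∘ e := funext hφ
    have h3 := monomialGrading_reindex e y (fun i => Pi.single i (1 : ZMod 2)) (E g)
    have h4 := monomialGrading_degree_equiv E (y ∘ e) (fun i => Pi.single i (1 : ZMod 2)) g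
    rw [h2] at h1
    refine h1.trans (h4.symm.trans (Eq.trans ?_ h3))
    congr 1
    funext i
    exact hE i
  refine ⟨φ, fun g => ⟨b (E (a.symm g)), ?_⟩, fun k => ⟨a (E.symm (b.symm k)), ?_⟩⟩
  · rw [← hb, ← key, ha, AddEquiv.apply_symm_apply]
  · have h1 := key (E.symm (b.symm k))
    rw [ha, AddEquiv.apply_symm_apply, hb, AddEquiv.apply_symm_apply] at h1
    rw [← h1, ← Submodule.map_comp]
    rintro _ ⟨r, hr, rfl⟩
    simpa using hr

/-- A grading that comes from a generating system has the corresponding presentation. -/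
lemma hasAnticommPresentation_of_system {n : ℕ} [Nontrivial R] {ε : ι → ℝ} {δ : Fin n → ℝ}
    [Finite ι] [DecidableEq ι] {x : ι → R} (h : IsAnticommSystem ε x) (hn : Even n)
    (hx : Algebra.adjoin ℝ (Set.range x) = ⊤) (e : Fin n ≃ ι) (he : ∀ i, ε (e i) = δ i)
    (𝒜 : G → Submodule ℝ R) (a : (ι → ZMod 2) ≃+ G)
    (ha : ∀ g, standardGrading x g = 𝒜 (a g)) : HasAnticommPresentation δ 𝒜 := by
  have hδ : ε ∘ e = δ := funext he
  have hh := h.comp_injective e e.injective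
  rw [hδ] at hh
  obtain ⟨φ, hφ⟩ := hh.exists_algEquiv_anticommAlgebra hn (by rwa [e.surjective.range_comp])
  refine ⟨_, (isElementaryBasis_single e).map_addEquiv a, φ.symm, fun g => ?_⟩
  obtain ⟨g, rfl⟩ := a.surjective g
  rw [monomialGrading_degree_equiv, ← ha]
  have h1 := monomialGrading_map φ.symm.toAlgHom (x ∘ e)
    (fun i => Pi.single (e i) (1 : ZMod 2)) g
  have h2 := monomialGrading_reindex e x (fun i => Pi.single i (1 : ZMod 2)) g
  have h3 : φ.symm.toAlgHom ∘ x ∘ e = anticommGen δ := by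
    funext i
    exact (AlgEquiv.symm_apply_eq φ).2 (hφ i).symm
  rw [h3] at h1
  rw [← h1]
  exact congrArg (Submodule.map φ.symm.toLinearMap) h2.symm

end Degrees

/-! ### Ordering the signs -/

lemma card_lt_filter (n p : ℕ) (hp : p ≤ n) :
    Fintype.card {i : Fin n // i.val < p} = p := by
  rw [Fintype.card_subtype]
  simp [Fin.card_filter_val_lt, hp]

open Classical in
/-- The number of negative signs of a family. -/
noncomputable def negCount {ι : Type*} [Fintype ι] (ε : ι → ℝ) : ℕ :=
  ∑ i, if ε i = -1 then 1 else 0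

lemma negCount_eq_card {ι : Type*} [Fintype ι] (ε : ι → ℝ) :
    negCount ε = Nat.card {i // ε i = -1} := by
  classical
  rw [Nat.card_eq_fintype_card, Fintype.card_subtype, Finset.card_filter, negCount]

lemma negCount_sumElim {ι κ : Type*} [Fintype ι] [Fintype κ] (ε : ι → ℝ) (δ : κ → ℝ) :
    negCount (Sum.elim ε δ) = negCount ε + negCount δ :=
  Fintype.sum_sum_type _

open Classical in
lemma negCount_pair (a b : ℝ) :
    negCount ![a, b] = (if a = -1 then 1 else 0) + if b = -1 then 1 else 0 :=
  Fin.sum_univ_two _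

lemma negCount_le_card {ι : Type*} [Fintype ι] (ε : ι → ℝ) : negCount ε ≤ Fintype.card ι := by
  rw [negCount_eq_card, ← Nat.card_eq_fintype_card]
  exact Nat.card_le_card_of_injective _ Subtype.val_injective

/-- A family of signs with the right number of negatives is `firstNegative` up to ordering. -/
lemma exists_equiv_firstNegative {ι : Type*} [Fintype ι] {ε : ι → ℝ}
    (hε : ∀ i, ε i = -1 ∨ ε i = 1) (n p : ℕ) (hp : p ≤ n) (hn : Fintype.card ι = n)
    (hc : negCount ε = p) :
    ∃ e : Fin n ≃ ι, ∀ i, ε (e i) = firstNegative n p i := by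
  classical
  replace hc : Fintype.card {i // ε i = -1} = p := by
    rw [← hc, negCount_eq_card, Nat.card_eq_fintype_card]
  let e1 : {i : Fin n // i.val < p} ≃ {i // ε i = -1} :=
    Fintype.equivOfCardEq (by rw [hc, card_lt_filter n p hp])
  let e2 : {i : Fin n // ¬ i.val < p} ≃ {i // ¬ ε i = -1} :=
    Fintype.equivOfCardEq (by
      rw [Fintype.card_subtype_compl, Fintype.card_subtype_compl, hc, card_lt_filter n p hp, hn,
        Fintype.card_fin])
  refine ⟨(Equiv.sumCompl _).symm.trans ((e1.sumCongr e2).trans (Equiv.sumCompl _)), fun i => ?_⟩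
  by_cases hi : i.val < p
  · simp [firstNegative, hi, Equiv.sumCompl_symm_apply_of_pos, (e1 ⟨i, hi⟩).2]
  · simp [firstNegative, hi, Equiv.sumCompl_symm_apply_of_neg,
      (hε (e2 ⟨i, hi⟩).1).resolve_left (e2 ⟨i, hi⟩).2]

/-! ### Division gradings -/

section Division

variable {G : Type u} [AddCommGroup G] [DecidableEq G] {R : Type v} [Ring R] [Algebra ℝ R]
  {𝒜 : G → Submodule ℝ R} [GradedAlgebra 𝒜]

/-- In the degree zero part of ab = 1 only the component of b in degree -g appears, so this
component is already the inverse of a. -/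
lemma inverse_mem_of_mem {g : G} {a b : R} (ha : a ∈ 𝒜 g) (hab : a * b = 1) (hba : b * a = 1) :
    b ∈ 𝒜 (-g) := by
  have h1 := DirectSum.coe_decompose_mul_add_of_left_mem 𝒜 (j := -g) (b := b) ha
  rw [add_neg_cancel, hab,
    DirectSum.decompose_of_mem_same 𝒜 (SetLike.GradedOne.one_mem (A := 𝒜))] at h1
  have h2 : b = (DirectSum.decompose 𝒜 b (-g) : R) := by
    conv_lhs => rw [← mul_one b, h1, ← mul_assoc, hba, one_mul]
  rw [h2]
  exact SetLike.coe_mem _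

/-- An identity of linear maps holds if it holds on homogeneous elements. -/
lemma linearMap_ext_homogeneous {M : Type*} [AddCommGroup M] [Module ℝ M] {f f' : R →ₗ[ℝ] M}
    (h : ∀ g, ∀ a ∈ 𝒜 g, f a = f' a) : f = f' := by
  ext a
  induction a using DirectSum.Decomposition.inductionOn 𝒜 with
  | zero => simp
  | homogeneous m => exact h _ _ m.2
  | add a b ha hb => rw [map_add, map_add, ha, hb]

variable (𝒜) in
lemma exists_algebraMap_eq_of_commute_homogeneous [Algebra.IsCentral ℝ R] {x : R}
    (h : ∀ g, ∀ a ∈ 𝒜 g, x * a = a * x) : ∃ c : ℝ, x = algebraMap ℝ R c := by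
  have h1 : LinearMap.mulLeft ℝ x = LinearMap.mulRight ℝ x :=
    linearMap_ext_homogeneous (𝒜 := 𝒜) h
  have h2 : x ∈ Subalgebra.center ℝ R := by
    rw [Subalgebra.mem_center_iff]
    intro b
    exact (LinearMap.congr_fun h1 b).symm
  rw [Algebra.IsCentral.center_eq_bot ℝ R, Algebra.mem_bot] at h2
  obtain ⟨c, hc⟩ := h2
  exact ⟨c, hc.symm⟩

/-- In a fine grading, a homogeneous element whose square is a nonzero scalar commutes or
anticommutes with each component. -/
lemma commute_or_anticommute_of_isFineGrading (hf : IsFineGrading 𝒜) {g : G} {y : R}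
    (hy : y ∈ 𝒜 g) {c : ℝ} (hc : c ≠ 0) (hyc : y * y = algebraMap ℝ R c) (k : G) :
    (∀ a ∈ 𝒜 k, y * a = a * y) ∨ (∀ a ∈ 𝒜 k, y * a = -(a * y)) := by
  by_contra! hcon
  obtain ⟨⟨a₁, ha₁, ha₁'⟩, a₂, ha₂, ha₂'⟩ := hcon
  -- The elements commuting (s = 0) or anticommuting (s = 1) with y. Their intersections with the
  -- components will form a grading by G × ℤ/2.
  let E : ZMod 2 → Submodule ℝ R := fun s =>
    LinearMap.ker (LinearMap.mulLeft ℝ y - zmodSign s • LinearMap.mulRight ℝ y)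
  have hE : ∀ s a, a ∈ E s ↔ y * a = zmodSign s • (a * y) := fun s a => by
    simp [E, sub_eq_zero]
  let ℬ : G × ZMod 2 → Submodule ℝ R := fun p => 𝒜 p.1 ⊓ E p.2
  -- Conjugation by y, since y⁻¹ = c⁻¹ y; it is an involution with eigenspaces E s.
  let f : R →ₗ[ℝ] R := c⁻¹ • (LinearMap.mulLeft ℝ y ∘ₗ LinearMap.mulRight ℝ y)
  have hf' : ∀ a, f a = c⁻¹ • (y * (a * y)) := fun a => rfl
  have hff : ∀ a, f (f a) = a := fun a => by
    rw [hf', hf', smul_mul_assoc, mul_smul_comm, smul_smul]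
    rw [show y * (y * (a * y) * y) = (y * y) * a * (y * y) by simp only [mul_assoc], hyc,
      ← Algebra.commutes, ← mul_assoc, ← map_mul, ← Algebra.smul_def, smul_smul]
    rw [show c⁻¹ * c⁻¹ * (c * c) = 1 by field_simp, one_smul]
  have hfE : ∀ s a, a ∈ E s ↔ f a = zmodSign s • a := fun s a => by
    rw [hE, hf']
    constructor
    · intro h
      rw [← mul_assoc, h, smul_mul_assoc, mul_assoc, hyc, ← Algebra.commutes, ← Algebra.smul_def,
        smul_comm, inv_smul_smul₀ hc]
    · intro h
      have h1 : (c⁻¹ • (y * (a * y))) * y = (zmodSign s • a) * y := by rw [h]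
      rw [smul_mul_assoc, ← mul_assoc, mul_assoc (y * a), hyc, ← Algebra.commutes,
        ← Algebra.smul_def, smul_smul, inv_mul_cancel₀ hc, one_smul, smul_mul_assoc] at h1
      exact h1
  -- As y⁻¹ has degree -g and G is abelian, conjugation preserves degrees.
  have hfm : ∀ k, ∀ a ∈ 𝒜 k, f a ∈ 𝒜 k := by
    intro k a ha
    have hinv : c⁻¹ • y ∈ 𝒜 (-g) := by
      refine inverse_mem_of_mem hy ?_ ?_
      · rw [mul_smul_comm, hyc, Algebra.smul_def, ← map_mul, inv_mul_cancel₀ hc, map_one]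
      · rw [smul_mul_assoc, hyc, Algebra.smul_def, ← map_mul, inv_mul_cancel₀ hc, map_one]
    have h1 := SetLike.GradedMul.mul_mem hy (SetLike.GradedMul.mul_mem ha hinv)
    rw [add_comm k, add_neg_cancel_left] at h1
    rw [hf']
    simpa [mul_smul_comm] using h1
  let P : G × ZMod 2 → R →ₗ[ℝ] R := fun p =>
    (2 : ℝ)⁻¹ • (LinearMap.id + zmodSign p.2 • f) ∘ₗ GradedAlgebra.proj 𝒜 p.1
  have hP : ∀ p a, P p a = (2 : ℝ)⁻¹ • ((DirectSum.decompose 𝒜 a p.1 : R) +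
      zmodSign p.2 • f (DirectSum.decompose 𝒜 a p.1 : R)) := fun p a => rfl
  have hPmem : ∀ p a, P p a ∈ ℬ p := by
    intro p a
    have hm := SetLike.coe_mem (DirectSum.decompose 𝒜 a p.1)
    refine ⟨?_, ?_⟩
    · rw [hP]
      exact Submodule.smul_mem _ _ (add_mem hm (Submodule.smul_mem _ _ (hfm _ _ hm)))
    · change P p a ∈ E p.2
      rw [hfE, hP, map_smul, map_add, map_smul, hff,
        smul_comm (zmodSign p.2) (2 : ℝ)⁻¹, smul_add (zmodSign p.2), smul_smul (zmodSign p.2),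
        zmodSign_mul_self, one_smul, add_comm]
  have hind : iSupIndep ℬ := by
    refine iSupIndep_of_projections ℬ P ?_ ?_
    · rintro ⟨k, s⟩ a ⟨h1, h2⟩
      rw [hP, DirectSum.decompose_of_mem_same 𝒜 h1, (hfE s a).1 h2, smul_smul,
        zmodSign_mul_self, one_smul, ← two_smul ℝ, smul_smul]
      norm_num
    · rintro ⟨k, s⟩ ⟨k', s'⟩ hne a ⟨h1, h2⟩
      rw [hP]
      by_cases hk : k' = k
      · subst hk
        have hs : s ≠ s' := by rintro rfl; exact hne rfl
        rw [DirectSum.decompose_of_mem_same 𝒜 h1, (hfE s' a).1 h2, smul_smul,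
          zmodSign_mul_of_ne hs, neg_one_smul, add_neg_cancel, smul_zero]
      · rw [DirectSum.decompose_of_mem_ne 𝒜 h1 hk]
        simp
  have hsum : ∀ k a, a ∈ 𝒜 k → a = P (k, 0) a + P (k, 1) a := by
    intro k a ha
    rw [hP, hP, DirectSum.decompose_of_mem_same 𝒜 ha, zmodSign_zero, zmodSign_one, one_smul,
      neg_one_smul, ← smul_add, add_add_add_comm, add_neg_cancel, add_zero, ← two_smul ℝ,
      smul_smul]
    norm_num
  have htop : ⨆ p, ℬ p = ⊤ := by
    rw [eq_top_iff, ← (DirectSum.Decomposition.isInternal 𝒜).submodule_iSup_eq_top]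
    refine iSup_le fun k a ha => ?_
    rw [hsum k a ha]
    exact add_mem (le_iSup ℬ (k, 0) (hPmem _ _)) (le_iSup ℬ (k, 1) (hPmem _ _))
  have hmon : SetLike.GradedMonoid ℬ :=
    { one_mem := ⟨SetLike.GradedOne.one_mem, by
        change (1 : R) ∈ E 0
        rw [hE, zmodSign_zero]; simp⟩
      mul_mem := by
        rintro ⟨k, s⟩ ⟨k', s'⟩ a b ⟨h1, h2⟩ ⟨h3, h4⟩
        refine ⟨SetLike.GradedMul.mul_mem h1 h3, ?_⟩
        change a * b ∈ E (s + s')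
        replace h2 := (hE _ _).1 h2
        replace h4 := (hE _ _).1 h4
        rw [hE, ← mul_assoc, h2, smul_mul_assoc, mul_assoc, h4, mul_smul_comm, smul_smul,
          zmodSign_add, mul_assoc] }
  let _ : GradedAlgebra ℬ :=
    { hmon, (DirectSum.isInternal_submodule_of_iSupIndep_of_iSup_eq_top hind
        htop).chooseDecomposition with }
  -- The refinement is proper at (k, 0): a zero component would make y anticommute with all of 𝒜 k,
  -- against a₂, and a full one would make it commute, against a₁.
  refine hf (G × ZMod 2) ℬ ⟨fun p => ⟨p.1, inf_le_left⟩, (k, 0), ?_, k, inf_le_left, ?_⟩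
  · intro h0
    apply ha₂'
    have h1 : P (k, 0) a₂ = 0 := by
      have := hPmem (k, 0) a₂
      rwa [h0, Submodule.mem_bot] at this
    have h2 := hsum k a₂ ha₂
    rw [h1, zero_add] at h2
    have h3 := (hPmem (k, 1) a₂).2
    rw [← h2] at h3
    have h4 := (hE _ _).1 h3
    rwa [zmodSign_one, neg_one_smul] at h4
  · intro hle
    apply ha₁'
    have h4 := (hE _ _).1 (hle ha₁).2
    rwa [zmodSign_zero, one_smul] at h4

/-- In a division grading whose support generates the group, every component is nonzero. -/
lemma component_ne_bot [Nontrivial R] (hd : IsDivisionGrading 𝒜)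
    (hs : AddSubgroup.closure (gradingSupport 𝒜) = ⊤) (g : G) : 𝒜 g ≠ ⊥ := by
  have hg : g ∈ AddSubgroup.closure (gradingSupport 𝒜) := by rw [hs]; trivial
  have key : ∀ g, 𝒜 g ≠ ⊥ ↔ ∃ a ∈ 𝒜 g, IsUnit a := by
    intro g
    rw [Submodule.ne_bot_iff]
    exact ⟨fun ⟨a, ha, h0⟩ => ⟨a, ha, hd g a ha h0⟩, fun ⟨a, ha, h0⟩ => ⟨a, ha, h0.ne_zero⟩⟩
  induction hg using AddSubgroup.closure_induction with
  | mem g hg => exact hg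
  | zero => exact (key 0).2 ⟨1, SetLike.GradedOne.one_mem, isUnit_one⟩
  | add g h _ _ hg hh =>
    obtain ⟨a, ha, ha'⟩ := (key g).1 hg
    obtain ⟨b, hb, hb'⟩ := (key h).1 hh
    exact (key _).2 ⟨a * b, SetLike.GradedMul.mul_mem ha hb, ha'.mul hb'⟩
  | neg g _ hg =>
    obtain ⟨a, ha, u, rfl⟩ := (key g).1 hg
    exact (key _).2 ⟨_, inverse_mem_of_mem ha u.mul_inv u.inv_mul, u⁻¹.isUnit⟩

lemma finite_of_forall_ne_bot [FiniteDimensional ℝ R] (h : ∀ g, 𝒜 g ≠ ⊥) : Finite G := by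
  have h1 := WellFoundedGT.finite_ne_bot_of_iSupIndep
    (DirectSum.Decomposition.isInternal 𝒜).submodule_iSupIndep
  rw [Set.eq_univ_of_forall (s := {i | 𝒜 i ≠ ⊥}) h] at h1
  exact Set.finite_univ_iff.1 h1

lemma algebraMap_mem_zero (c : ℝ) : algebraMap ℝ R c ∈ 𝒜 0 := by
  rw [Algebra.algebraMap_eq_smul_one]
  exact Submodule.smul_mem _ _ SetLike.GradedOne.one_mem

/-- A degree zero element of a division grading is a real combination of `1` and a square root of
`-1` of degree zero. -/
lemma exists_decomposition_degree_zero [Nontrivial R] [FiniteDimensional ℝ R]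
    (hd : IsDivisionGrading 𝒜) {c : R} (hc : c ∈ 𝒜 0) :
    (∃ r : ℝ, c = algebraMap ℝ R r) ∨
      ∃ i ∈ 𝒜 0, i * i = -1 ∧ ∃ p q : ℝ, c = algebraMap ℝ R p + q • i := by
  by_cases hr : ∃ r : ℝ, c = algebraMap ℝ R r
  · exact Or.inl hr
  right
  -- The identity component is a finite-dimensional real domain, so minimal polynomials are
  -- irreducible over ℝ and have degree at most 2.
  have : IsDomain (𝒜 0) := by
    have : NoZeroDivisors (𝒜 0) := ⟨by
      rintro ⟨a, ha⟩ ⟨b, hb⟩ hab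
      by_cases h0 : a = 0
      · left; exact Subtype.ext h0
      · right
        have hab' : a * b = 0 := congrArg Subtype.val hab
        exact Subtype.ext ((hd 0 a ha h0).mul_right_eq_zero.1 hab')⟩
    have : Nontrivial (𝒜 0) := ⟨0, 1, fun h => zero_ne_one (congrArg Subtype.val h)⟩
    exact NoZeroDivisors.to_isDomain _
  let c' : 𝒜 0 := ⟨c, hc⟩
  have hint : IsIntegral ℝ c' := Algebra.IsIntegral.isIntegral c'
  have hirr := minpoly.irreducible hint
  have hmon := minpoly.monic hint
  have hdeg := hirr.natDegree_le_two
  have hae := minpoly.aeval ℝ c'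
  rw [Polynomial.aeval_eq_sum_range' (Nat.lt_succ_of_le hdeg)] at hae
  simp only [Finset.sum_range_succ, Finset.sum_range_zero, zero_add, pow_zero, pow_one,
    sq] at hae
  have hcr : ∀ r : ℝ, c' ≠ r • 1 := fun r h => hr ⟨r, by
    rw [Algebra.algebraMap_eq_smul_one]; exact congrArg Subtype.val h⟩
  have hdeg2 : (minpoly ℝ c').natDegree = 2 := by
    have h0 : (minpoly ℝ c').natDegree ≠ 0 := hirr.natDegree_pos.ne'
    have h1 : (minpoly ℝ c').natDegree ≠ 1 := fun h1 => by
      have h2 : (minpoly ℝ c').coeff 2 = 0 := Polynomial.coeff_eq_zero_of_natDegree_lt (by omega)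
      have h3 : (minpoly ℝ c').coeff 1 = 1 := by rw [← h1]; exact hmon
      rw [h2, h3, zero_smul, one_smul, add_zero] at hae
      exact hcr _ ((eq_neg_of_add_eq_zero_right hae).trans (neg_smul _ _).symm)
    omega
  have h2 : (minpoly ℝ c').coeff 2 = 1 := by rw [← hdeg2]; exact hmon
  rw [h2, one_smul] at hae
  set a₀ := (minpoly ℝ c').coeff 0
  set a₁ := (minpoly ℝ c').coeff 1
  -- Completing the square. A nonnegative right-hand side would factor in a domain and make c real;
  -- a negative one rescales to a square root of -1.
  have htt : (c' + (a₁ / 2) • 1) * (c' + (a₁ / 2) • 1) = (a₁ ^ 2 / 4 - a₀) • 1 := by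
    have h3 : c' * c' = -(a₀ • 1 + a₁ • c') := (neg_eq_of_add_eq_zero_right hae).symm
    simp only [mul_add, add_mul, mul_smul_comm, smul_mul_assoc, mul_one, one_mul, h3]
    module
  by_cases hD : 0 ≤ a₁ ^ 2 / 4 - a₀
  · exfalso
    have h4 : (c' + (a₁ / 2) • 1 - √(a₁ ^ 2 / 4 - a₀) • 1) *
        (c' + (a₁ / 2) • 1 + √(a₁ ^ 2 / 4 - a₀) • 1) = 0 := by
      rw [mul_add, sub_mul, sub_mul, htt]
      simp only [mul_smul_comm, smul_mul_assoc, mul_one, one_mul, smul_smul,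
        Real.mul_self_sqrt hD]
      module
    rcases mul_eq_zero.1 h4 with h5 | h5
    · refine hcr (√(a₁ ^ 2 / 4 - a₀) - a₁ / 2) ?_
      rw [← sub_eq_zero, ← h5]; module
    · refine hcr (-√(a₁ ^ 2 / 4 - a₀) - a₁ / 2) ?_
      rw [← sub_eq_zero, ← h5]; module
  · have hD' : 0 < -(a₁ ^ 2 / 4 - a₀) := by linarith
    set s := √(-(a₁ ^ 2 / 4 - a₀)) with hs
    have hs0 : s ≠ 0 := (Real.sqrt_pos.2 hD').ne'
    have hss : s * s = -(a₁ ^ 2 / 4 - a₀) := Real.mul_self_sqrt hD'.le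
    let i : 𝒜 0 := s⁻¹ • (c' + (a₁ / 2) • 1)
    have hii : i * i = -1 := by
      simp only [i, mul_smul_comm, smul_mul_assoc, htt, smul_smul]
      rw [show s⁻¹ * (s⁻¹ * (a₁ ^ 2 / 4 - a₀)) = -1 by
        rw [show a₁ ^ 2 / 4 - a₀ = -(s * s) by rw [hss, neg_neg]]; field_simp]
      rw [neg_one_smul]
    refine ⟨i, i.2, congrArg Subtype.val hii, -(a₁ / 2), s, ?_⟩
    have h6 : c' = (-(a₁ / 2)) • 1 + s • i := by
      simp only [i, smul_smul, mul_inv_cancel₀ hs0]; module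
    rw [Algebra.algebraMap_eq_smul_one]
    exact congrArg Subtype.val h6

/-- The commutator of two homogeneous units has degree zero. -/
lemma exists_commutator {g h : G} {x y : R} (hx : x ∈ 𝒜 g) (hy : y ∈ 𝒜 h) (hxu : IsUnit x)
    (hyu : IsUnit y) : ∃ c ∈ 𝒜 0, x * y = c * (y * x) := by
  obtain ⟨u, hu⟩ := hyu.mul hxu
  have h1 := inverse_mem_of_mem (hu ▸ SetLike.GradedMul.mul_mem hy hx) u.mul_inv u.inv_mul
  refine ⟨x * y * (u⁻¹ : Rˣ), ?_, ?_⟩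
  · have h2 := SetLike.GradedMul.mul_mem (SetLike.GradedMul.mul_mem hx hy) h1
    rwa [add_comm h g, add_neg_cancel] at h2
  · rw [← hu, mul_assoc, u.inv_mul, mul_one]

/-- If a power of `y` commutes with `x` and `y` commutes with `x` up to a scalar, the scalar has
absolute value one. -/
lemma abs_eq_one_of_pow_commute [Nontrivial R] {x y : R} (hx : IsUnit x) (hy : IsUnit y) {r : ℝ}
    (h : y * x = r • (x * y)) {n : ℕ} (hn : n ≠ 0) (hc : y ^ n * x = x * y ^ n) : |r| = 1 := by
  have h1 : ∀ m : ℕ, y ^ m * x = r ^ m • (x * y ^ m) := by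
    intro m
    induction m with
    | zero => simp
    | succ m ih =>
      rw [pow_succ, mul_assoc, h, mul_smul_comm, ← mul_assoc, ih, smul_mul_assoc, smul_smul,
        mul_assoc, ← pow_succ, pow_succ' r]
  have h2 : r ^ n • (x * y ^ n) = (1 : ℝ) • (x * y ^ n) := by rw [← h1, hc, one_smul]
  have h3 : r ^ n = 1 := smul_left_injective ℝ (hx.mul (hy.pow n)).ne_zero h2
  have h4 : |r| ^ n = 1 := by rw [← abs_pow, h3, abs_one]
  exact (pow_eq_one_iff_of_nonneg (abs_nonneg r) hn).1 h4

lemma pow_card_mem_zero {g : G} {x : R} (hx : x ∈ 𝒜 g) : x ^ Nat.card G ∈ 𝒜 0 := by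
  have h1 := SetLike.pow_mem_graded (A := 𝒜) (Nat.card G) hx
  rwa [card_nsmul_eq_zero'] at h1

/-- The identity component of a fine division grading on a central simple real algebra is
one-dimensional. -/
lemma degree_zero_eq_real [Nontrivial R] [FiniteDimensional ℝ R] [Algebra.IsCentral ℝ R]
    (hs : AddSubgroup.closure (gradingSupport 𝒜) = ⊤) (hd : IsDivisionGrading 𝒜)
    (hf : IsFineGrading 𝒜) {c : R} (hc : c ∈ 𝒜 0) : ∃ r : ℝ, c = algebraMap ℝ R r := by
  have hbot := component_ne_bot hd hs
  have hfin : Finite G := finite_of_forall_ne_bot hbot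
  rcases exists_decomposition_degree_zero hd hc with h | ⟨i, hi, hii, -⟩
  · exact h
  exfalso
  have hii' : i * i = algebraMap ℝ R (-1) := by rw [hii, map_neg, map_one]
  have hi0 : i ≠ 0 := by rintro rfl; simp at hii
  have no_two : ∀ {a : R}, a = -a → a = 0 := fun {a} h => by
    have h1 : (2 : ℝ) • a = 0 := by rw [two_smul]; nth_rewrite 1 [h]; exact neg_add_cancel a
    exact (smul_eq_zero.1 h1).resolve_left two_ne_zero
  -- The dichotomy applied to degree zero: anticommuting is excluded because 1 lies there.
  have hcomm0 : ∀ g, ∀ {y : R}, y ∈ 𝒜 g → ∀ {r : ℝ}, r ≠ 0 → y * y = algebraMap ℝ R r →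
      ∀ a ∈ 𝒜 0, y * a = a * y := by
    intro g y hy r hr hyr
    rcases commute_or_anticommute_of_isFineGrading hf hy hr hyr 0 with h | h
    · exact h
    · exfalso
      have h1 := h 1 SetLike.GradedOne.one_mem
      rw [mul_one, one_mul] at h1
      rw [no_two h1, mul_zero] at hyr
      exact (map_ne_zero_iff _ (algebraMap ℝ R).injective).2 hr hyr.symm
  have hi_comm := hcomm0 0 hi (by norm_num) hii'
  -- Another root j of -1 commutes with i, so (i - j)(i + j) = 0 and j = ±i. Thus the identity
  -- component is ℝ + ℝi.
  have hform : ∀ c ∈ 𝒜 0, ∃ p q : ℝ, c = algebraMap ℝ R p + q • i := by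
    intro c hc
    rcases exists_decomposition_degree_zero hd hc with ⟨r, h⟩ | ⟨j, hj, hjj, p, q, h⟩
    · exact ⟨r, 0, by rw [zero_smul, add_zero, h]⟩
    · have h1 : (i - j) * (i + j) = 0 := by
        rw [mul_add, sub_mul, sub_mul, hii, hjj, hi_comm j hj]; abel
      by_cases h2 : i - j = 0
      · exact ⟨p, q, by rw [sub_eq_zero.1 h2, h]⟩
      · have h3 := (hd 0 _ (sub_mem hi hj) h2).mul_right_eq_zero.1 h1
        exact ⟨p, -q, by rw [h, neg_smul, ← smul_neg, eq_neg_of_add_eq_zero_right h3]⟩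
  have hdich := commute_or_anticommute_of_isFineGrading hf hi (by norm_num) hii'
  -- Otherwise i is central, hence real, which i² = -1 forbids.
  obtain ⟨g, hg⟩ : ∃ g, ∀ a ∈ 𝒜 g, i * a = -(a * i) := by
    by_contra! hcon
    obtain ⟨r, hr⟩ := exists_algebraMap_eq_of_commute_homogeneous 𝒜 (x := i) fun g => by
      rcases hdich g with h | h
      · exact h
      · obtain ⟨a, ha, ha'⟩ := hcon g
        exact absurd (h a ha) ha'
    rw [hr, ← map_mul] at hii'
    have := (algebraMap ℝ R).injective hii'
    nlinarith [mul_self_nonneg r]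
  obtain ⟨x, hx, hx0⟩ := (Submodule.ne_bot_iff _).1 (hbot g)
  have hxu := hd g x hx hx0
  have hix : i * x = -(x * i) := hg x hx
  -- Write xX = cXx with c = p + qi. Moving x past c conjugates it, so x²X = (p² + q²)Xx², and it
  -- remains to see that the norm is 1.
  have key : ∀ h, (∀ a ∈ 𝒜 h, i * a = a * i) → ∀ a ∈ 𝒜 h, x * x * a = a * (x * x) := by
    intro h hh X hX
    by_cases hX0 : X = 0
    · simp [hX0]
    have hXu := hd h X hX hX0
    obtain ⟨c, hc, hcx⟩ := exists_commutator hx hX hxu hXu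
    obtain ⟨p, q, rfl⟩ := hform c hc
    have h1 : x * x * X = (p ^ 2 + q ^ 2) • (X * (x * x)) := by
      have hxi : x * i = -(i * x) := by rw [hix, neg_neg]
      have h2 : x * (algebraMap ℝ R p + q • i) = (algebraMap ℝ R p - q • i) * x := by
        rw [mul_add, sub_mul, mul_smul_comm, hxi, smul_mul_assoc, Algebra.commutes, smul_neg,
          sub_eq_add_neg]
      have h3 : (algebraMap ℝ R p - q • i) * (algebraMap ℝ R p + q • i) =
          algebraMap ℝ R (p ^ 2 + q ^ 2) := by
        simp only [sub_mul, mul_add, smul_mul_assoc, mul_smul_comm, hii,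
          Algebra.algebraMap_eq_smul_one, one_mul, mul_one]
        module
      rw [mul_assoc, hcx, ← mul_assoc, h2, mul_assoc, ← mul_assoc x X x, hcx, mul_assoc, ← mul_assoc,
        h3, Algebra.smul_def, mul_assoc X]
    -- The power of x² with exponent the order of G lies in ℝ + ℝi, hence commutes with X.
    have h4 := abs_eq_one_of_pow_commute hXu (hxu.mul hxu) h1 Nat.card_pos.ne' (by
      obtain ⟨p', q', h⟩ := hform _ (pow_card_mem_zero (SetLike.GradedMul.mul_mem hx hx))
      rw [h, add_mul, mul_add, smul_mul_assoc, mul_smul_comm, hh X hX, Algebra.commutes])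
    rw [abs_of_nonneg (by positivity)] at h4
    rw [h1, h4, one_smul]
  obtain ⟨r, hr⟩ := exists_algebraMap_eq_of_commute_homogeneous 𝒜 (x := x * x) fun h a ha => by
    rcases hdich h with hh | hh
    · exact key h hh a ha
    · by_cases ha0 : a = 0
      · simp [ha0]
      -- Both x and a anticommute with i, so xa commutes with i and `key` applies to its component;
      -- x is then cancelled.
      have h1 := key (g + h) (fun b hb => by
        rcases hdich (g + h) with h2 | h2
        · exact h2 b hb
        · exfalso
          have h3 := h2 (x * a) (SetLike.GradedMul.mul_mem hx ha)
          have h4 : i * (x * a) = x * a * i := by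
            rw [← mul_assoc, hix, neg_mul, mul_assoc, hh a ha, mul_neg, neg_neg, mul_assoc]
          rw [h4] at h3
          exact ((hxu.mul (hd h a ha ha0)).mul (hd 0 i hi hi0)).ne_zero (no_two h3))
        (x * a) (SetLike.GradedMul.mul_mem hx ha)
      refine hxu.mul_left_cancel ?_
      rw [← mul_assoc x a, ← h1]
      simp only [mul_assoc]
  have hr0 : r ≠ 0 := by
    rintro rfl
    rw [map_zero] at hr
    exact (hxu.mul hxu).ne_zero hr
  -- Now x² is a nonzero real, so fineness makes x commute with i, against the choice of x.
  have h1 := hcomm0 g hx hr0 hr i hi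
  rw [hix] at h1
  have h2 : x * i = 0 := no_two h1
  exact (hxu.mul (hd 0 i hi hi0)).ne_zero h2

end Division

/-! ### Division gradings with real identity component -/

section RealIdentity

variable {G : Type u} [AddCommGroup G] [DecidableEq G] {R : Type v} [Ring R] [Algebra ℝ R]
  {𝒜 : G → Submodule ℝ R} [GradedAlgebra 𝒜]

/-- For b in the same component, a⁻¹b has degree zero, hence is real. -/
lemma component_eq_span (h0 : ∀ c ∈ 𝒜 0, ∃ r : ℝ, c = algebraMap ℝ R r) {g : G} {a : R}
    (ha : a ∈ 𝒜 g) (hu : IsUnit a) : 𝒜 g = Submodule.span ℝ {a} := by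
  refine le_antisymm (fun b hb => ?_) ((Submodule.span_singleton_le_iff_mem _ _).2 ha)
  obtain ⟨u, rfl⟩ := hu
  have h1 := SetLike.GradedMul.mul_mem (inverse_mem_of_mem ha u.mul_inv u.inv_mul) hb
  rw [neg_add_cancel] at h1
  obtain ⟨r, hr⟩ := h0 _ h1
  refine Submodule.mem_span_singleton.2 ⟨r, ?_⟩
  rw [Algebra.smul_def, Algebra.commutes, ← hr, ← mul_assoc, u.mul_inv, one_mul]

/-- The commutator is real, and a positive power of x is real and so commutes with y; this forces
absolute value 1. -/
lemma commute_or_anticommute_of_mem [Nontrivial R] [Finite G]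
    (h0 : ∀ c ∈ 𝒜 0, ∃ r : ℝ, c = algebraMap ℝ R r) {g h : G} {x y : R} (hx : x ∈ 𝒜 g)
    (hy : y ∈ 𝒜 h) (hxu : IsUnit x) (hyu : IsUnit y) : ∃ s : ZMod 2, x * y = zmodSign s • (y * x) := by
  obtain ⟨c, hc, hcx⟩ := exists_commutator hx hy hxu hyu
  obtain ⟨r, rfl⟩ := h0 c hc
  rw [← Algebra.smul_def] at hcx
  have h1 := abs_eq_one_of_pow_commute hyu hxu hcx Nat.card_pos.ne' (by
    obtain ⟨p, hp⟩ := h0 _ (pow_card_mem_zero hx)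
    rw [hp, Algebra.commutes])
  rcases eq_or_eq_neg_of_abs_eq h1 with rfl | rfl
  · exact ⟨0, by rw [hcx, zmodSign_zero]⟩
  · exact ⟨1, by rw [hcx, zmodSign_one]⟩

/-- Passing x twice through a homogeneous element squares a sign, so x² is central. -/
lemma exists_mul_self_eq [Nontrivial R] [Finite G] [Algebra.IsCentral ℝ R]
    (hd : IsDivisionGrading 𝒜) (h0 : ∀ c ∈ 𝒜 0, ∃ r : ℝ, c = algebraMap ℝ R r) {g : G} {x : R}
    (hx : x ∈ 𝒜 g) (hxu : IsUnit x) : ∃ r : ℝ, r ≠ 0 ∧ x * x = algebraMap ℝ R r := by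
  obtain ⟨r, hr⟩ := exists_algebraMap_eq_of_commute_homogeneous 𝒜 (x := x * x) fun h a ha => by
    by_cases ha0 : a = 0
    · simp [ha0]
    obtain ⟨s, hs⟩ := commute_or_anticommute_of_mem h0 hx ha hxu (hd h a ha ha0)
    rw [mul_assoc, hs, mul_smul_comm, ← mul_assoc, hs, smul_mul_assoc, smul_smul,
      zmodSign_mul_self, one_smul, mul_assoc]
  refine ⟨r, ?_, hr⟩
  rintro rfl
  exact (hxu.mul hxu).ne_zero (by rw [hr, map_zero])

/-- The nonzero real x² has degree both g + g and 0. -/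
lemma add_self_eq_zero_of_mem [Nontrivial R] [Finite G] [Algebra.IsCentral ℝ R]
    (hd : IsDivisionGrading 𝒜) (h0 : ∀ c ∈ 𝒜 0, ∃ r : ℝ, c = algebraMap ℝ R r) {g : G} {x : R}
    (hx : x ∈ 𝒜 g) (hxu : IsUnit x) : g + g = 0 := by
  obtain ⟨r, -, hr⟩ := exists_mul_self_eq hd h0 hx hxu
  have h1 := SetLike.GradedMul.mul_mem hx hx
  rw [hr] at h1
  exact DirectSum.degree_eq_of_mem_mem 𝒜 h1 (algebraMap_mem_zero r) (by
    rw [← hr]; exact (hxu.mul hxu).ne_zero)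

/-- Every homogeneous unit can be scaled to have square `1` or `-1`. -/
lemma exists_smul_mul_self_eq_sign [Nontrivial R] [Finite G] [Algebra.IsCentral ℝ R]
    (hd : IsDivisionGrading 𝒜) (h0 : ∀ c ∈ 𝒜 0, ∃ r : ℝ, c = algebraMap ℝ R r) {g : G} {x : R}
    (hx : x ∈ 𝒜 g) (hxu : IsUnit x) :
    ∃ t : ℝ, t ≠ 0 ∧ ∃ σ : ℝ, (σ = -1 ∨ σ = 1) ∧ (t • x) * (t • x) = algebraMap ℝ R σ := by
  obtain ⟨r, hr0, hr⟩ := exists_mul_self_eq hd h0 hx hxu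
  have hpos : 0 < |r| := abs_pos.2 hr0
  have ht : √|r| ≠ 0 := (Real.sqrt_pos.2 hpos).ne'
  refine ⟨(√|r|)⁻¹, inv_ne_zero ht, r / |r|, ?_, ?_⟩
  · rcases abs_choice r with h | h
    · right; rw [h, div_self hr0]
    · left; rw [h, div_neg, div_self hr0]
  · rw [smul_mul_assoc, mul_smul_comm, hr, smul_smul, Algebra.smul_def, ← map_mul, ← mul_inv,
      Real.mul_self_sqrt hpos.le, div_eq_inv_mul]

end RealIdentity

/-! ### Extending systems of anticommuting elements -/

lemma mul_list_prod_comm {ι R : Type*} [Ring R] {x : ι → R} {a : R} (ha : ∀ i, a * x i = x i * a) (l : List ι) :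
    a * (l.map x).prod = (l.map x).prod * a := by
  induction l with
  | nil => simp
  | cons b l ih => rw [List.map_cons, List.prod_cons, ← mul_assoc, ha, mul_assoc, ih, mul_assoc]

namespace IsAnticommSystem

variable {ι R : Type*} [Ring R] [Algebra ℝ R] {ε : ι → ℝ} {x : ι → R}

section Extend

variable {ω a b : R} {s α β : ℝ}

/-- The factor ω supplies the sign against the old generators, while it commutes with a and b and so
contributes only s to the new squares. -/
lemma extend (h : IsAnticommSystem ε x) (hω : ∀ i, ω * x i = -(x i * ω))
    (hωω : ω * ω = algebraMap ℝ R s) (hs : s ≠ 0) (ha : ∀ i, a * x i = x i * a)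
    (hb : ∀ i, b * x i = x i * b) (haω : a * ω = ω * a) (hbω : b * ω = ω * b)
    (haa : a * a = algebraMap ℝ R α) (hα : α ≠ 0) (hbb : b * b = algebraMap ℝ R β) (hβ : β ≠ 0)
    (hab : a * b = -(b * a)) :
    IsAnticommSystem (Sum.elim ε ![s * α, s * β]) (Sum.elim x ![ω * a, ω * b]) := by
  have hsq : ∀ {c : R} {γ : ℝ}, c * ω = ω * c → c * c = algebraMap ℝ R γ →
      ω * c * (ω * c) = algebraMap ℝ R (s * γ) := by
    intro c γ h1 h2
    rw [mul_assoc, ← mul_assoc c, h1, mul_assoc, h2, ← mul_assoc, hωω, map_mul]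
  have hanti : ∀ {c : R}, (∀ i, c * x i = x i * c) → ∀ i, ω * c * x i = -(x i * (ω * c)) := by
    intro c h1 i
    rw [mul_assoc, h1, ← mul_assoc, hω, neg_mul, mul_assoc]
  have hωab : ω * a * (ω * b) = -(ω * b * (ω * a)) := by
    rw [mul_assoc, ← mul_assoc a, haω, mul_assoc ω b, ← mul_assoc b, hbω]
    simp only [mul_assoc]
    rw [hab]; simp only [mul_neg]
  refine ⟨?_, ?_, ?_⟩
  · rintro (i | i)
    · exact h.sq i
    · fin_cases i
      · exact hsq haω haa
      · exact hsq hbω hbb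
  · rintro (i | i) (j | j) hij
    · exact h.anticomm i j (by rintro rfl; exact hij rfl)
    · fin_cases j
      · exact (neg_eq_iff_eq_neg.1 (hanti ha i).symm)
      · exact (neg_eq_iff_eq_neg.1 (hanti hb i).symm)
    · fin_cases i
      · exact hanti ha j
      · exact hanti hb j
    · fin_cases i <;> fin_cases j
      · exact absurd rfl hij
      · exact hωab
      · exact (neg_eq_iff_eq_neg.1 hωab.symm)
      · exact absurd rfl hij
  · rintro (i | i)
    · exact h.ne_zero i
    · fin_cases i
      · exact mul_ne_zero hs hα
      · exact mul_ne_zero hs hβ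

/-- The new top word equals s·ωab. Its three factors ω, ωa, ωb each anticommute with an old
generator, and exactly one of them anticommutes with each new generator. Its square is s²·s·(ab)²,
with (ab)² = -αβ. -/
lemma extend_top (hω : ∀ i, ω * x i = -(x i * ω))
    (hωω : ω * ω = algebraMap ℝ R s) (ha : ∀ i, a * x i = x i * a)
    (hb : ∀ i, b * x i = x i * b) (haω : a * ω = ω * a) (hbω : b * ω = ω * b)
    (haa : a * a = algebraMap ℝ R α) (hbb : b * b = algebraMap ℝ R β)
    (hab : a * b = -(b * a)) :
    (∀ i, ω * (ω * a * (ω * b)) * (Sum.elim x ![ω * a, ω * b] i) =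
      -(Sum.elim x ![ω * a, ω * b] i * (ω * (ω * a * (ω * b))))) ∧
    ω * (ω * a * (ω * b)) * (ω * (ω * a * (ω * b))) = algebraMap ℝ R (-(s ^ 3 * α * β)) := by
  have hba : b * a = -(a * b) := by rw [hab, neg_neg]
  have haω' : ∀ t, a * (ω * t) = ω * (a * t) := fun t => by rw [← mul_assoc, haω, mul_assoc]
  have hbω' : ∀ t, b * (ω * t) = ω * (b * t) := fun t => by rw [← mul_assoc, hbω, mul_assoc]
  have hba' : ∀ t, b * (a * t) = -(a * (b * t)) := fun t => by
    rw [← mul_assoc, hba, neg_mul, mul_assoc]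
  rw [Algebra.algebraMap_eq_smul_one] at hωω haa hbb
  have hωω' : ∀ t, ω * (ω * t) = s • t := fun t => by
    rw [← mul_assoc, hωω, smul_mul_assoc, one_mul]
  have haa' : ∀ t, a * (a * t) = α • t := fun t => by
    rw [← mul_assoc, haa, smul_mul_assoc, one_mul]
  have hbb' : ∀ t, b * (b * t) = β • t := fun t => by
    rw [← mul_assoc, hbb, smul_mul_assoc, one_mul]
  have hax : ∀ i t, a * (x i * t) = x i * (a * t) := fun i t => by
    rw [← mul_assoc, ha, mul_assoc]
  refine ⟨?_, ?_⟩
  · rintro (i | i)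
    · simp only [Sum.elim_inl, mul_assoc, haω', hωω', hb, hax,
        mul_smul_comm, smul_mul_assoc]
      simp only [← mul_assoc, hω, neg_mul]
      module
    · fin_cases i <;>
        simp only [Sum.elim_inr, mul_assoc, haω, haω', hbω', hωω', hba, hba', haa',
          hbb, mul_neg, mul_smul_comm, smul_mul_assoc, mul_one, Fin.zero_eta, Fin.mk_one,
          Matrix.cons_val_zero, Matrix.cons_val_one] <;>
        module
  · rw [Algebra.algebraMap_eq_smul_one]
    simp only [mul_assoc, haω', hbω', hωω, hωω', hba', haa, hbb, mul_neg, mul_smul_comm, smul_mul_assoc, mul_one, smul_neg]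
    module

end Extend

end IsAnticommSystem

/-! ### Existence of generating systems -/

section Greedy

variable {G : Type u} [AddCommGroup G] [DecidableEq G] {R : Type v} [Ring R] [Algebra ℝ R]
  {𝒜 : G → Submodule ℝ R} [GradedAlgebra 𝒜]

/-- A system of `2 * k` homogeneous anticommuting elements `x i` with squares `±1`, with a word
`ω` in them that anticommutes with them, such that either `k` of the squares are negative and
`ω * ω = 1`, or `k + 1` are negative and `ω * ω = -1`. -/
def IsSignedSystem (𝒜 : G → Submodule ℝ R) (k : ℕ) {ι : Type} [Fintype ι] (ε : ι → ℝ)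
    (x : ι → R) (d : ι → G) : Prop :=
  Fintype.card ι = 2 * k ∧ IsAnticommSystem ε x ∧ (∀ i, ε i = -1 ∨ ε i = 1) ∧
    (∀ i, x i ∈ 𝒜 (d i)) ∧ ∃ l : List ι,
      (∀ i, (l.map x).prod * x i = -(x i * (l.map x).prod)) ∧
      ∃ s : ℝ, (l.map x).prod * (l.map x).prod = algebraMap ℝ R s ∧
        ((s = 1 ∧ negCount ε = k) ∨
          (s = -1 ∧ negCount ε = k + 1))

/-- Some unit times a word commutes with the given system. -/
lemma IsAnticommSystem.exists_mul_prod_comm {ι : Type*} [Fintype ι] {ε : ι → ℝ} {x : ι → R}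
    (h : IsAnticommSystem ε x) (hι : Even (Fintype.card ι)) {z : R}
    (hz : ∀ i, ∃ s : ZMod 2, z * x i = zmodSign s • (x i * z)) :
    ∃ l : List ι, ∀ i, z * (l.map x).prod * x i = x i * (z * (l.map x).prod) := by
  classical
  choose p hp using hz
  -- In even rank every sign pattern is that of a word, so a word with the signs of z cancels them.
  obtain ⟨g, hg⟩ := commDegree_surjective hι p
  obtain ⟨l, rfl⟩ := exists_wordDegree_eq g
  refine ⟨l, fun i => ?_⟩
  have h1 : (l.map x).prod * x i = zmodSign (p i) • (x i * (l.map x).prod) := by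
    rw [h.mul_prod, hg, smul_smul, zmodSign_mul_self, one_smul]
  rw [mul_assoc, h1, mul_smul_comm, ← mul_assoc, hp, smul_mul_assoc, smul_smul,
    zmodSign_mul_self, one_smul, mul_assoc]

/-- Two anticommuting homogeneous units can be replaced by ones whose squares are `-1` and `±1`. -/
lemma exists_normalized_pair [Nontrivial R] [Finite G] [Algebra.IsCentral ℝ R]
    (hd : IsDivisionGrading 𝒜) (h0 : ∀ c ∈ 𝒜 0, ∃ r : ℝ, c = algebraMap ℝ R r) {g h : G} {a b : R}
    (ha : a ∈ 𝒜 g) (hb : b ∈ 𝒜 h) (hau : IsUnit a) (hbu : IsUnit b) (hab : a * b = -(b * a)) :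
    ∃ g' h', ∃ a' ∈ 𝒜 g', ∃ b' ∈ 𝒜 h', a' * b' = -(b' * a') ∧ a' * a' = algebraMap ℝ R (-1) ∧
      (∃ β : ℝ, (β = -1 ∨ β = 1) ∧ b' * b' = algebraMap ℝ R β) ∧
      ∀ y, a * y = y * a → b * y = y * b → a' * y = y * a' ∧ b' * y = y * b' := by
  obtain ⟨t, -, α, hα, hαα⟩ := exists_smul_mul_self_eq_sign hd h0 ha hau
  obtain ⟨u, -, β, hβ, hββ⟩ := exists_smul_mul_self_eq_sign hd h0 hb hbu
  have ha' : t • a ∈ 𝒜 g := Submodule.smul_mem _ _ ha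
  have hb' : u • b ∈ 𝒜 h := Submodule.smul_mem _ _ hb
  have hab' : t • a * u • b = -(u • b * t • a) := by
    simp only [smul_mul_assoc, mul_smul_comm, hab, smul_neg]; rw [smul_comm]
  have hcomm : ∀ y, a * y = y * a → b * y = y * b →
      t • a * y = y * t • a ∧ u • b * y = y * u • b := fun y h1 h2 => by
    simp only [smul_mul_assoc, mul_smul_comm, h1, h2, and_self]
  generalize t • a = a₁ at *
  generalize u • b = b₁ at *
  rcases hα with rfl | rfl
  · exact ⟨g, h, a₁, ha', b₁, hb', hab', hαα, ⟨β, hβ, hββ⟩, hcomm⟩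
  rcases hβ with rfl | rfl
  · exact ⟨h, g, b₁, hb', a₁, ha', by rw [hab', neg_neg], hββ, ⟨1, Or.inr rfl, hαα⟩,
      fun y h1 h2 => (hcomm y h1 h2).symm⟩
  -- Both squares are 1; then (ab)² = -a²b² = -1, and ab takes the place of a.
  · rw [map_one] at hαα hββ
    refine ⟨g + h, h, a₁ * b₁, SetLike.GradedMul.mul_mem ha' hb', b₁, hb', ?_, ?_,
      ⟨1, Or.inr rfl, by rw [hββ, map_one]⟩, fun y h1 h2 => ⟨?_, (hcomm y h1 h2).2⟩⟩
    · rw [← mul_assoc b₁, ← neg_eq_iff_eq_neg.2 hab', mul_assoc, neg_mul, neg_neg, mul_assoc]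
    · rw [mul_assoc, ← mul_assoc b₁, ← neg_eq_iff_eq_neg.2 hab', neg_mul, mul_assoc a₁, hββ,
        mul_one, mul_neg, hαα, map_neg, map_one]
    · rw [mul_assoc, (hcomm y h1 h2).2, ← mul_assoc, (hcomm y h1 h2).1, mul_assoc]

/-- The unit y commutes with the system but is not central. A partner anticommuting with y,
corrected by a word, gives the pair used to extend the system. -/
lemma IsSignedSystem.exists_succ [Nontrivial R] [Finite G] [Algebra.IsCentral ℝ R]
    (hd : IsDivisionGrading 𝒜) (h0 : ∀ c ∈ 𝒜 0, ∃ r : ℝ, c = algebraMap ℝ R r) {k : ℕ}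
    {ι : Type} [Fintype ι] {ε : ι → ℝ} {x : ι → R} {d : ι → G} (h : IsSignedSystem 𝒜 k ε x d)
    {g : G} {y : R} (hy : y ∈ 𝒜 g) (hg : g ≠ 0) (hyu : IsUnit y)
    (hyx : ∀ i, y * x i = x i * y) :
    ∃ (ε' : ι ⊕ Fin 2 → ℝ) (x' : ι ⊕ Fin 2 → R) (d' : ι ⊕ Fin 2 → G),
      IsSignedSystem 𝒜 (k + 1) ε' x' d' := by
  obtain ⟨hcard, hsys, hε, hx, l, hl, s, hls, hs⟩ := h
  have hι : Even (Fintype.card ι) := ⟨k, by omega⟩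
  have hprod : ∀ l : List ι, (l.map x).prod ∈ 𝒜 (l.map d).sum := fun l =>
    SetLike.list_prod_map_mem_graded l d x fun i _ => hx i
  -- If y commuted with all homogeneous elements it would be real, hence of degree zero.
  obtain ⟨g', z, hz, hyz⟩ : ∃ g', ∃ z ∈ 𝒜 g', y * z ≠ z * y := by
    by_contra! hcon
    obtain ⟨c, rfl⟩ := exists_algebraMap_eq_of_commute_homogeneous 𝒜 hcon
    exact hg (DirectSum.degree_eq_of_mem_mem 𝒜 hy (algebraMap_mem_zero c) hyu.ne_zero)
  have hzu : IsUnit z := hd g' z hz (by rintro rfl; simp at hyz)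
  have hyz' : y * z = -(z * y) := by
    obtain ⟨t, ht⟩ := commute_or_anticommute_of_mem h0 hy hz hyu hzu
    rcases zmod_two_cases t with rfl | rfl
    · rw [zmodSign_zero, one_smul] at ht; exact absurd ht hyz
    · rwa [zmodSign_one, neg_one_smul] at ht
  -- Since y commutes with words in the system, multiplying z by one keeps its anticommutation with
  -- y.
  obtain ⟨l', hl'⟩ := hsys.exists_mul_prod_comm hι fun i =>
    commute_or_anticommute_of_mem h0 hz (hx i) hzu (hsys.isUnit i)
  have hyz'' : y * (z * (l'.map x).prod) = -(z * (l'.map x).prod * y) := by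
    rw [← mul_assoc, hyz', neg_mul, mul_assoc, mul_list_prod_comm hyx, mul_assoc]
  obtain ⟨p, q, a, ha, b, hb, hab, haa, ⟨β, hβ, hbb⟩, hcomm⟩ := exists_normalized_pair hd h0 hy
    (SetLike.GradedMul.mul_mem hz (hprod l')) hyu (hzu.mul (hsys.isUnit_prod l')) hyz''
  have hax : ∀ i, a * x i = x i * a := fun i => (hcomm _ (hyx i) (hl' i)).1
  have hbx : ∀ i, b * x i = x i * b := fun i => (hcomm _ (hyx i) (hl' i)).2
  have haω := mul_list_prod_comm hax l
  have hbω := mul_list_prod_comm hbx l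
  have hs1 : s = -1 ∨ s = 1 := by tauto
  have hs0 : s ≠ 0 := by rcases hs1 with rfl | rfl <;> norm_num
  have hβ0 : β ≠ 0 := by rcases hβ with rfl | rfl <;> norm_num
  obtain ⟨t1, t2⟩ := IsAnticommSystem.extend_top hl hls hax hbx haω hbω haa hbb hab
  refine ⟨_, _, Sum.elim d ![(l.map d).sum + p, (l.map d).sum + q], ?_,
    hsys.extend hl hls hs0 hax hbx haω hbω haa (by norm_num) hbb hβ0 hab, ?_, ?_,
    l.map Sum.inl ++ [Sum.inr 0, Sum.inr 1], ?_⟩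
  · simp [hcard]; ring
  · rintro (i | i)
    · exact hε i
    · fin_cases i
      · rcases hs1 with rfl | rfl <;> simp
      · rcases hs1 with rfl | rfl <;> rcases hβ with rfl | rfl <;> simp
  · rintro (i | i)
    · exact hx i
    · fin_cases i
      · exact SetLike.GradedMul.mul_mem (hprod l) ha
      · exact SetLike.GradedMul.mul_mem (hprod l) hb
  · have hw : ((l.map Sum.inl ++ [Sum.inr (0 : Fin 2), Sum.inr 1]).map
        (Sum.elim x ![(l.map x).prod * a, (l.map x).prod * b])).prod =
        (l.map x).prod * ((l.map x).prod * a * ((l.map x).prod * b)) := by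
      simp
    rw [hw]
    refine ⟨t1, _, t2, ?_⟩
    -- As a² = -1, the new squares are -s and sβ and the new top squares to sβ. For (s, β) = (1, 1),
    -- (1, -1), (-1, 1), (-1, -1) the negative count grows by 1, 2, 1, 0, which matches the
    -- invariant for k + 1.
    rcases hs with ⟨rfl, hs⟩ | ⟨rfl, hs⟩ <;> rcases hβ with rfl | rfl <;> 
      norm_num [negCount_sumElim, hs, negCount_pair]

lemma isSignedSystem_zero {G : Type u} {R : Type v} [Ring R] [Algebra ℝ R]
    {𝒜 : G → Submodule ℝ R} :
    IsSignedSystem 𝒜 0 (fun i : Fin 0 => i.elim0) (fun i => i.elim0) (fun i => i.elim0) :=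
  ⟨rfl, ⟨fun i => i.elim0, fun i => i.elim0, fun i => i.elim0⟩, fun i => i.elim0,
    fun i => i.elim0, [], fun i => i.elim0, 1, by simp, Or.inl ⟨rfl, rfl⟩⟩

/-- There is a signed system that generates the graded algebra. -/
lemma exists_isSignedSystem_generating [Nontrivial R] [Finite G] [FiniteDimensional ℝ R]
    [Algebra.IsCentral ℝ R] (hd : IsDivisionGrading 𝒜)
    (h0 : ∀ c ∈ 𝒜 0, ∃ r : ℝ, c = algebraMap ℝ R r) (hbot : ∀ g, 𝒜 g ≠ ⊥) :
    ∃ (k : ℕ) (ι : Type) (_ : Fintype ι) (ε : ι → ℝ) (x : ι → R) (d : ι → G),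
      IsSignedSystem 𝒜 k ε x d ∧ ∀ g, ∃ l : List ι, (l.map d).sum = g := by
  -- If no system spans G, each one extends, so systems of every size exist.
  by_contra! hcon
  have step : ∀ k : ℕ, ∃ (ι : Type) (_ : Fintype ι) (ε : ι → ℝ) (x : ι → R) (d : ι → G),
      IsSignedSystem 𝒜 k ε x d := by
    intro k
    induction k with
    | zero => exact ⟨_, inferInstance, _, _, _, isSignedSystem_zero⟩
    | succ k ih =>
      obtain ⟨ι, _, ε, x, d, h⟩ := ih
      obtain ⟨g, hg⟩ := hcon k ι inferInstance ε x d h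
      have ⟨hcard, hsys, _, hx, _⟩ := h
      obtain ⟨z, hz, hz0⟩ := (Submodule.ne_bot_iff _).1 (hbot g)
      have hzu := hd g z hz hz0
      obtain ⟨l, hl⟩ := hsys.exists_mul_prod_comm (z := z) ⟨k, by omega⟩ fun i =>
        commute_or_anticommute_of_mem h0 hz (hx i) hzu (hsys.isUnit i)
      have hy := SetLike.GradedMul.mul_mem hz (SetLike.list_prod_map_mem_graded (A := 𝒜) l d x
        fun i _ => hx i)
      have hw := add_self_eq_zero_of_mem hd h0 (SetLike.list_prod_map_mem_graded (A := 𝒜) l d x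
        fun i _ => hx i) (hsys.isUnit_prod l)
      -- Degree zero here would make g the degree of a word, since degrees of words are 2-torsion.
      obtain ⟨ε', x', d', h'⟩ := h.exists_succ hd h0 hy (fun h1 => hg l (by
        rw [← add_left_inj (l.map d).sum, hw, h1])) (hzu.mul (hsys.isUnit_prod l)) hl
      exact ⟨_, inferInstance, ε', x', d', h'⟩
  -- Size k = dim R suffices for the contradiction, since 2^(2k) > k.
  obtain ⟨ι, _, ε, x, d, hcard, hsys, -⟩ := step (Module.finrank ℝ R)
  classical
  have hev : Even (Fintype.card ι) := ⟨_, hcard.trans (two_mul _)⟩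
  have h1 := hsys.pow_card_le_finrank hev
  rw [hcard] at h1
  have h2 := Nat.lt_two_pow_self (n := 2 * Module.finrank ℝ R)
  omega

end Greedy

/-! ### Clifford algebras -/

section Cliff

variable (p m : ℕ)

lemma standardForm_single (i : Fin (p + m)) :
    (-standardForm p m) (Pi.single i 1) = firstNegative (p + m) p i := by
  simp only [standardForm, neg_apply, QuadraticMap.weightedSumSquares_apply,
    firstNegative]
  rw [Finset.sum_eq_single i]
  · split_ifs <;> simp
  · intro j _ hj
    simp [Pi.single_eq_of_ne hj]
  · simp

lemma firstNegative_eq (n p : ℕ) (i : Fin n) :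
    firstNegative n p i = -1 ∨ firstNegative n p i = 1 := by
  rw [firstNegative]
  split_ifs <;> simp

lemma firstNegative_ne_zero (n p : ℕ) (i : Fin n) : firstNegative n p i ≠ 0 := by
  rcases firstNegative_eq n p i with h | h <;> rw [h] <;> norm_num

lemma isAnticommSystem_cliffGen :
    IsAnticommSystem (firstNegative (p + m) p) (cliffGen p m) where
  sq i := by rw [cliffGen, CliffordAlgebra.ι_sq_scalar, standardForm_single]
  anticomm i j hij := by
    refine CliffordAlgebra.ι_mul_ι_comm_of_isOrtho ?_
    rw [QuadraticMap.isOrtho_def]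
    simp only [standardForm, neg_apply, QuadraticMap.weightedSumSquares_apply, ← neg_add,
      ← Finset.sum_add_distrib]
    refine congrArg _ (Finset.sum_congr rfl fun l _ => ?_)
    by_cases hl : l = i
    · subst hl
      simp [Pi.single_eq_of_ne hij]
    · simp [Pi.single_eq_of_ne hl]
  ne_zero := firstNegative_ne_zero _ _

lemma adjoin_cliffGen : Algebra.adjoin ℝ (Set.range (cliffGen p m)) = ⊤ := by
  rw [eq_top_iff, ← CliffordAlgebra.adjoin_range_ι]
  refine Algebra.adjoin_le ?_
  rintro _ ⟨v, rfl⟩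
  rw [← Finset.univ_sum_single v, map_sum]
  refine sum_mem fun i _ => ?_
  have : (Pi.single i (v i) : Fin (p + m) → ℝ) = v i • Pi.single i 1 := by
    rw [← Pi.single_smul, smul_eq_mul, mul_one]
  rw [this, map_smul]
  exact Subalgebra.smul_mem _ (Algebra.subset_adjoin (Set.mem_range_self i)) _

end Cliff

/-! ### Comparison with the Clifford models and the classification -/

/-- A generating system with `2 * k` elements and `p` negative squares gives the equivalence with
the graded Clifford algebra and the presentation. -/
lemma equivalent_and_presentation_of_system {ι : Type*} [Fintype ι] [DecidableEq ι] {G : Type*}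
    [AddCommGroup G] {R : Type*} [Ring R] [Algebra ℝ R] [Nontrivial R] {ε : ι → ℝ} {x : ι → R}
    (h : IsAnticommSystem ε x) (hε : ∀ i, ε i = -1 ∨ ε i = 1)
    (hx : Algebra.adjoin ℝ (Set.range x) = ⊤) {k p m : ℕ} (hpm : p + m = 2 * k)
    (hc : Fintype.card ι = 2 * k) (hneg : negCount ε = p)
    (𝒜 : G → Submodule ℝ R) (a : (ι → ZMod 2) ≃+ G)
    (ha : ∀ g, standardGrading x g = 𝒜 (a g)) :
    Nonempty (Cliff p m ≃ₐ[ℝ] R) ∧ GradingEquivalent (cliffGrading p m) 𝒜 ∧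
      GradingEquivalent 𝒜 (cliffGrading p m) ∧
      HasAnticommPresentation (firstNegative (2 * k) p) 𝒜 := by
  obtain ⟨e, he⟩ := exists_equiv_firstNegative hε (2 * k) p (by omega) hc hneg
  obtain ⟨f, hf⟩ := exists_equiv_firstNegative hε (p + m) p (by omega) (by omega) hneg
  have hcl := isAnticommSystem_cliffGen p m
  have hev : Even (Fintype.card (Fin (p + m))) := ⟨k, by rw [Fintype.card_fin]; omega⟩
  have hev' : Even (Fintype.card ι) := ⟨k, by omega⟩
  refine ⟨?_, ?_, ?_, ?_⟩
  · obtain ⟨φ, -⟩ := hcl.exists_algEquiv h hev (adjoin_cliffGen p m) hx f hf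
    exact ⟨φ⟩
  · exact gradingEquivalent_of_systems hcl h hev (adjoin_cliffGen p m) hx f hf _ _
      (AddEquiv.refl _) (fun _ => rfl) a ha
  · exact gradingEquivalent_of_systems h hcl hev' hx (adjoin_cliffGen p m) f.symm
      (fun i => by rw [← hf, Equiv.apply_symm_apply]) _ _ a ha (AddEquiv.refl _) (fun _ => rfl)
  · exact hasAnticommPresentation_of_system h ⟨k, two_mul k⟩ hx e he 𝒜 a ha

/-- Classification of the fine division gradings on central simple real algebras. -/
lemma classification_of_isFineGrading {G : Type u} [AddCommGroup G] [DecidableEq G] {R : Type v}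
    [Ring R] [Algebra ℝ R] [FiniteDimensional ℝ R] [Algebra.IsCentral ℝ R] [Nontrivial R]
    (𝒜 : G → Submodule ℝ R) [GradedAlgebra 𝒜]
    (hs : AddSubgroup.closure (gradingSupport 𝒜) = ⊤)
    (hd : IsDivisionGrading 𝒜) (hf : IsFineGrading 𝒜) :
    (∀ g : G, Module.finrank ℝ (𝒜 g) = 1) ∧ (∀ g : G, g + g = 0) ∧
      ((∃ k : ℕ, GradingEquivalent 𝒜 (cliffGrading k k) ∧
          HasAnticommPresentation (firstNegative (2 * k) k) 𝒜) ∨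
        (∃ k : ℕ, 1 ≤ k ∧ GradingEquivalent 𝒜 (cliffGrading (k + 1) (k - 1)) ∧
          HasAnticommPresentation (firstNegative (2 * k) (k + 1)) 𝒜)) := by
  classical
  have hbot := component_ne_bot hd hs
  have hfin : Finite G := finite_of_forall_ne_bot hbot
  have h0 : ∀ c ∈ 𝒜 0, ∃ r : ℝ, c = algebraMap ℝ R r := fun c hc =>
    degree_zero_eq_real hs hd hf hc
  have hspan : ∀ g, ∃ a, IsUnit a ∧ a ∈ 𝒜 g ∧ 𝒜 g = Submodule.span ℝ {a} := fun g => by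
    obtain ⟨a, ha, ha0⟩ := (Submodule.ne_bot_iff _).1 (hbot g)
    exact ⟨a, hd g a ha ha0, ha, component_eq_span h0 ha (hd g a ha ha0)⟩
  have hG : ∀ g : G, g + g = 0 := fun g => by
    obtain ⟨a, hu, ha, -⟩ := hspan g
    exact add_self_eq_zero_of_mem hd h0 ha hu
  refine ⟨fun g => ?_, hG, ?_⟩
  · obtain ⟨a, hu, -, h⟩ := hspan g
    rw [h]
    exact finrank_span_singleton hu.ne_zero
  · obtain ⟨k, ι, _, ε, x, d, ⟨hcard, hsys, hε, hx, l, hl, s, hls, hneg⟩, hsurj⟩ :=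
      exists_isSignedSystem_generating hd h0 hbot
    obtain ⟨hgen, e, -, he⟩ := hsys.exists_addEquiv ⟨k, hcard.trans (two_mul _)⟩ 𝒜 hG
      (fun g => by obtain ⟨a, -, -, h⟩ := hspan g; exact ⟨a, h⟩)
      (DirectSum.Decomposition.isInternal 𝒜).submodule_iSup_eq_top d hx hsurj
    rcases hneg with ⟨-, hneg⟩ | ⟨-, hneg⟩
    · left
      obtain ⟨-, -, h1, h2⟩ := equivalent_and_presentation_of_system hsys hε hgen
        (two_mul k).symm hcard hneg 𝒜 e he
      exact ⟨k, h1, h2⟩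
    · right
      -- The k + 1 negative squares are among 2k.
      have hk : 1 ≤ k := by
        have h1 := negCount_le_card ε
        omega
      obtain ⟨-, -, h1, h2⟩ := equivalent_and_presentation_of_system hsys hε hgen
        (m := k - 1) (by omega) hcard hneg 𝒜 e he
      exact ⟨k, hk, h1, h2⟩

/-! ### The gradings `M_2^(4)` and `ℍ^(4)` -/

lemma sylvesterA_mul_self : sylvesterA * sylvesterA = 1 := by
  ext i j; fin_cases i <;> fin_cases j <;> simp [sylvesterA]

lemma sylvesterB_mul_self : sylvesterB * sylvesterB = 1 := by
  ext i j; fin_cases i <;> fin_cases j <;> simp [sylvesterB]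

lemma sylvesterB_mul_sylvesterA : sylvesterB * sylvesterA = -(sylvesterA * sylvesterB) := by
  ext i j; fin_cases i <;> fin_cases j <;> simp [sylvesterA, sylvesterB]

lemma zmod_two_val_zero : (0 : ZMod 2).val = 0 := rfl

lemma zmod_two_val_one : (1 : ZMod 2).val = 1 := rfl

lemma zmod_two_one_add_one : (1 : ZMod 2) + 1 = 0 := rfl

/-- If `a` and `b` anticommute and have real squares, the lines spanned by `1`, `a`, `b`, `a * b`
are closed under multiplication. -/
lemma gradedMonoid_of_anticommuting_pair {R : Type*} [Ring R] [Algebra ℝ R] {a b : R} {α β : ℝ}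
    (haa : a * a = algebraMap ℝ R α) (hbb : b * b = algebraMap ℝ R β) (hba : b * a = -(a * b)) :
    SetLike.GradedMonoid
      (fun g : ZMod 2 × ZMod 2 => Submodule.span ℝ {a ^ g.1.val * b ^ g.2.val}) where
  one_mem := Submodule.mem_span_singleton.2 ⟨1, by simp⟩
  mul_mem := by
    intro g h x y hx hy
    obtain ⟨c, rfl⟩ := Submodule.mem_span_singleton.1 hx
    obtain ⟨d, rfl⟩ := Submodule.mem_span_singleton.1 hy
    rw [smul_mul_smul_comm]
    refine Submodule.smul_mem _ _ ?_
    obtain ⟨g1, g2⟩ := g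
    obtain ⟨h1, h2⟩ := h
    have hba' : ∀ t, b * (a * t) = -(a * (b * t)) := fun t => by
      rw [← mul_assoc, hba, neg_mul, mul_assoc]
    rw [Algebra.algebraMap_eq_smul_one] at haa hbb
    have haa' : ∀ t, a * (a * t) = α • t := fun t => by
      rw [← mul_assoc, haa, smul_mul_assoc, one_mul]
    rcases zmod_two_cases g1 with rfl | rfl <;> rcases zmod_two_cases g2 with rfl | rfl <;>
      rcases zmod_two_cases h1 with rfl | rfl <;> rcases zmod_two_cases h2 with rfl | rfl <;>
      simp only [zmod_two_val_zero, zmod_two_val_one, Prod.mk_add_mk, zmod_two_one_add_one,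
        add_zero, zero_add, pow_zero, pow_one, one_mul, mul_one, mul_assoc, haa, hbb, hba, haa', hba',
        mul_neg, mul_smul_comm, smul_smul] <;>
      first
        | exact Submodule.mem_span_singleton_self _
        | exact neg_mem (Submodule.mem_span_singleton_self _)
        | exact Submodule.smul_mem _ _ (Submodule.mem_span_singleton_self _)
        | exact neg_mem (Submodule.smul_mem _ _ (Submodule.mem_span_singleton_self _))

lemma m2Grading_gradedMonoid : SetLike.GradedMonoid m2Grading :=
  gradedMonoid_of_anticommuting_pair (α := 1) (β := 1) (by rw [sylvesterA_mul_self, map_one])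
    (by rw [sylvesterB_mul_self, map_one]) sylvesterB_mul_sylvesterA

/-- The quaternion units `i` and `j`. -/
noncomputable def quaternionI : ℍ[ℝ] := ⟨0, 1, 0, 0⟩

/-- The quaternion unit `j`. -/
noncomputable def quaternionJ : ℍ[ℝ] := ⟨0, 0, 1, 0⟩

lemma quaternionI_parts : quaternionI.re = 0 ∧ quaternionI.imI = 1 ∧ quaternionI.imJ = 0 ∧
    quaternionI.imK = 0 := ⟨rfl, rfl, rfl, rfl⟩

lemma quaternionJ_parts : quaternionJ.re = 0 ∧ quaternionJ.imI = 0 ∧ quaternionJ.imJ = 1 ∧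
    quaternionJ.imK = 0 := ⟨rfl, rfl, rfl, rfl⟩

lemma quaternionI_mul_self : quaternionI * quaternionI = algebraMap ℝ ℍ[ℝ] (-1) := by
  ext <;> simp [quaternionI_parts]

lemma quaternionJ_mul_self : quaternionJ * quaternionJ = algebraMap ℝ ℍ[ℝ] (-1) := by
  ext <;> simp [quaternionJ_parts]

lemma quaternionJ_mul_quaternionI :
    quaternionJ * quaternionI = -(quaternionI * quaternionJ) := by
  ext <;> simp [quaternionI_parts, quaternionJ_parts]

lemma quaternionGrading_gradedMonoid : SetLike.GradedMonoid quaternionGrading :=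
  gradedMonoid_of_anticommuting_pair quaternionI_mul_self quaternionJ_mul_self
    quaternionJ_mul_quaternionI

lemma sum_zmod_two_prod {M : Type*} [AddCommMonoid M] (f : ZMod 2 × ZMod 2 → M) :
    ∑ g, f g = (f (0, 0) + f (0, 1)) + (f (1, 0) + f (1, 1)) := by
  rw [Fintype.sum_prod_type]
  exact (Fin.sum_univ_two _).trans (congrArg₂ _ (Fin.sum_univ_two _) (Fin.sum_univ_two _))

lemma exists_sum_m2Grading (m : Matrix (Fin 2) (Fin 2) ℝ) :
    ∃ c : ZMod 2 × ZMod 2 → Matrix (Fin 2) (Fin 2) ℝ,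
      (∀ g, c g ∈ m2Grading g) ∧ m = ∑ g, c g := by
  -- Coordinates of m in the basis I, A, B, AB.
  let r : ZMod 2 × ZMod 2 → ℝ := fun g =>
    if g = (0, 0) then (m 0 0 + m 1 1) / 2 else if g = (1, 0) then (m 0 0 - m 1 1) / 2
      else if g = (0, 1) then (m 0 1 + m 1 0) / 2 else (m 0 1 - m 1 0) / 2
  refine ⟨fun g => r g • (sylvesterA ^ g.1.val * sylvesterB ^ g.2.val),
    fun g => Submodule.smul_mem _ _ (Submodule.mem_span_singleton_self _), ?_⟩
  rw [sum_zmod_two_prod]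
  ext i j
  fin_cases i <;> fin_cases j <;>
    simp [r, zmod_two_val_one, sylvesterA, sylvesterB] <;> ring

lemma iSup_quaternionGrading : ⨆ g, quaternionGrading g = ⊤ := by
  rw [eq_top_iff]
  rintro q -
  have h : q = q.re • (quaternionI ^ 0 * quaternionJ ^ 0) +
      q.imI • (quaternionI ^ 1 * quaternionJ ^ 0) + q.imJ • (quaternionI ^ 0 * quaternionJ ^ 1) +
      q.imK • (quaternionI ^ 1 * quaternionJ ^ 1) := by
    ext <;> simp [quaternionI_parts, quaternionJ_parts]
  have key : ∀ g : ZMod 2 × ZMod 2, ∀ r : ℝ,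
      r • (quaternionI ^ g.1.val * quaternionJ ^ g.2.val) ∈ ⨆ g, quaternionGrading g :=
    fun g r => le_iSup quaternionGrading g
      (Submodule.smul_mem _ _ (Submodule.mem_span_singleton_self _))
  rw [h]
  exact add_mem (add_mem (add_mem (key (0, 0) _) (key (1, 0) _)) (key (0, 1) _)) (key (1, 1) _)

/-- Products of elements of two spans lie in a submodule if the products of generators do. -/
lemma mul_mem_of_mem_span {R : Type*} [Ring R] [Algebra ℝ R] {s t : Set R} {P : Submodule ℝ R}
    (h : ∀ a ∈ s, ∀ b ∈ t, a * b ∈ P) {x y : R} (hx : x ∈ Submodule.span ℝ s)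
    (hy : y ∈ Submodule.span ℝ t) : x * y ∈ P := by
  have : Submodule.span ℝ s * Submodule.span ℝ t ≤ P := by
    rw [Submodule.span_mul_span, Submodule.span_le]
    rintro _ ⟨a, ha, b, hb, rfl⟩
    exact h a ha b hb
  exact this (Submodule.mul_mem_mul hx hy)

/-! ### The grading `(M_2^(4))^{⊗ k}` -/

section M2Power

variable {k : ℕ}

lemma m2PowerGrading_eq_span (g : Fin k → ZMod 2 × ZMod 2) :
    m2PowerGrading k g = Submodule.span ℝ
      {PiTensorProduct.tprod ℝ fun i => sylvesterA ^ (g i).1.val * sylvesterB ^ (g i).2.val} := by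
  refine le_antisymm (Submodule.span_le.2 ?_) (Submodule.span_mono ?_)
  · rintro _ ⟨a, ha, rfl⟩
    choose c hc using fun i => Submodule.mem_span_singleton.1 (ha i)
    obtain rfl : (fun i => c i • (sylvesterA ^ (g i).1.val * sylvesterB ^ (g i).2.val)) = a :=
      funext hc
    rw [MultilinearMap.map_smul_univ]
    exact Submodule.smul_mem _ _ (Submodule.mem_span_singleton_self _)
  · rintro _ rfl
    exact ⟨_, fun i => Submodule.mem_span_singleton_self _, rfl⟩

lemma tprod_mem_m2PowerGrading {g : Fin k → ZMod 2 × ZMod 2}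
    {a : Fin k → Matrix (Fin 2) (Fin 2) ℝ} (ha : ∀ i, a i ∈ m2Grading (g i)) :
    PiTensorProduct.tprod ℝ a ∈ m2PowerGrading k g :=
  Submodule.subset_span ⟨a, ha, rfl⟩

lemma m2PowerGrading_gradedMonoid : SetLike.GradedMonoid (m2PowerGrading k) where
  one_mem := by
    have := m2Grading_gradedMonoid
    rw [PiTensorProduct.one_def]
    exact tprod_mem_m2PowerGrading fun i => SetLike.GradedOne.one_mem (A := m2Grading)
  mul_mem := by
    intro g h a b ha hb
    have := m2Grading_gradedMonoid
    refine mul_mem_of_mem_span ?_ ha hb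
    rintro _ ⟨a, ha, rfl⟩ _ ⟨b, hb, rfl⟩
    rw [PiTensorProduct.tprod_mul_tprod]
    exact tprod_mem_m2PowerGrading fun i =>
      SetLike.GradedMul.mul_mem (A := m2Grading) (ha i) (hb i)

lemma iSup_m2PowerGrading : ⨆ g, m2PowerGrading k g = ⊤ := by
  rw [eq_top_iff, ← PiTensorProduct.span_tprod_eq_top, Submodule.span_le]
  rintro _ ⟨a, rfl⟩
  choose c hc hc' using fun i => exists_sum_m2Grading (a i)
  rw [show a = fun i => ∑ g, c i g from funext hc', MultilinearMap.map_sum]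
  exact sum_mem fun r _ => le_iSup (m2PowerGrading k) r
    (tprod_mem_m2PowerGrading fun i => hc i (r i))

/-- Pure tensors whose factors commute except at one place, where they anticommute,
anticommute. -/
lemma tprod_anticomm {a b : Fin k → Matrix (Fin 2) (Fin 2) ℝ} (i : Fin k)
    (hi : a i * b i = -(b i * a i)) (hl : ∀ l, l ≠ i → a l * b l = b l * a l) :
    PiTensorProduct.tprod ℝ a * PiTensorProduct.tprod ℝ b =
      -(PiTensorProduct.tprod ℝ b * PiTensorProduct.tprod ℝ a) := by
  rw [PiTensorProduct.tprod_mul_tprod, PiTensorProduct.tprod_mul_tprod]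
  have h : a * b = Function.update (b * a) i ((-1 : ℝ) • (b * a) i) := by
    funext l
    by_cases h : l = i
    · subst h; simp [hi]
    · simp [Function.update_of_ne h, hl l h]
  rw [h, MultilinearMap.map_update_smul, Function.update_eq_self, neg_one_smul]

/-- The tuple with `A` before the place `i`, `c` at this place, and `1` after it. -/
noncomputable def prefixTuple (c : Matrix (Fin 2) (Fin 2) ℝ) (i l : Fin k) :
    Matrix (Fin 2) (Fin 2) ℝ :=
  if l < i then sylvesterA else if l = i then c else 1

/-- The degree of `prefixTuple`. -/
def prefixDegree (γ : ZMod 2 × ZMod 2) (i l : Fin k) : ZMod 2 × ZMod 2 :=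
  if l < i then (1, 0) else if l = i then γ else 0

lemma tprod_prefixTuple_mul_self {c : Matrix (Fin 2) (Fin 2) ℝ} {σ : ℝ} (hc : c * c = σ • 1)
    (i : Fin k) :
    PiTensorProduct.tprod ℝ (prefixTuple c i) * PiTensorProduct.tprod ℝ (prefixTuple c i) =
      algebraMap ℝ (M2Power k) σ := by
  rw [PiTensorProduct.tprod_mul_tprod]
  have h : prefixTuple c i * prefixTuple c i =
      Function.update (1 : Fin k → Matrix (Fin 2) (Fin 2) ℝ) i
        (σ • (1 : Fin k → Matrix (Fin 2) (Fin 2) ℝ) i) := by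
    funext l
    rcases lt_trichotomy l i with h | h | h
    · simp [prefixTuple, h, Function.update_of_ne h.ne, sylvesterA_mul_self]
    · subst h; simp [prefixTuple, hc]
    · simp [prefixTuple, h.not_gt, h.ne']
  rw [h, MultilinearMap.map_update_smul, Function.update_eq_self, ← PiTensorProduct.one_def,
    Algebra.algebraMap_eq_smul_one]

/-- Before place i both factors are A, after it the first tuple is 1; only at i does c meet A. -/
lemma tprod_prefixTuple_anticomm_of_lt {c c' : Matrix (Fin 2) (Fin 2) ℝ}
    (hc : c * sylvesterA = -(sylvesterA * c)) {i j : Fin k} (hij : i < j) :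
    PiTensorProduct.tprod ℝ (prefixTuple c i) * PiTensorProduct.tprod ℝ (prefixTuple c' j) =
      -(PiTensorProduct.tprod ℝ (prefixTuple c' j) *
        PiTensorProduct.tprod ℝ (prefixTuple c i)) := by
  refine tprod_anticomm i ?_ fun l hl => ?_
  · simp [prefixTuple, hij, hc]
  · rcases lt_or_gt_of_ne hl with h | h
    · simp [prefixTuple, h, h.trans hij]
    · simp [prefixTuple, h.not_gt, h.ne']

lemma tprod_prefixTuple_anticomm {c c' : Matrix (Fin 2) (Fin 2) ℝ}
    (hc : c * sylvesterA = -(sylvesterA * c)) (hc' : c' * sylvesterA = -(sylvesterA * c'))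
    {i j : Fin k} (hij : i ≠ j) :
    PiTensorProduct.tprod ℝ (prefixTuple c i) * PiTensorProduct.tprod ℝ (prefixTuple c' j) =
      -(PiTensorProduct.tprod ℝ (prefixTuple c' j) *
        PiTensorProduct.tprod ℝ (prefixTuple c i)) := by
  rcases lt_or_gt_of_ne hij with h | h
  · exact tprod_prefixTuple_anticomm_of_lt hc h
  · rw [tprod_prefixTuple_anticomm_of_lt hc' h, neg_neg]

/-- The generators of `M_2(ℝ)^{⊗ k}`. -/
noncomputable def m2PowerGen (k : ℕ) : Fin k ⊕ Fin k → M2Power k :=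
  Sum.elim (fun i => PiTensorProduct.tprod ℝ (prefixTuple (sylvesterA * sylvesterB) i))
    (fun i => PiTensorProduct.tprod ℝ (prefixTuple sylvesterB i))

/-- The degrees of the generators of `M_2(ℝ)^{⊗ k}`. -/
def m2PowerDegree (k : ℕ) : Fin k ⊕ Fin k → Fin k → ZMod 2 × ZMod 2 :=
  Sum.elim (prefixDegree (1, 1)) (prefixDegree (0, 1))

/-- The squares of the generators of `M_2(ℝ)^{⊗ k}`. -/
noncomputable def m2PowerSign (k : ℕ) : Fin k ⊕ Fin k → ℝ :=
  Sum.elim (fun _ => -1) (fun _ => 1)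

/-- These are Jordan–Wigner generators: the prefix of A's makes different places anticommute, and at
the same place AB and B do so themselves. The squares are (AB)² = -1 and B² = 1. -/
lemma isAnticommSystem_m2PowerGen : IsAnticommSystem (m2PowerSign k) (m2PowerGen k) := by
  have hBA := sylvesterB_mul_sylvesterA
  have hABA : sylvesterA * sylvesterB * sylvesterA = -(sylvesterA * (sylvesterA * sylvesterB)) := by
    rw [mul_assoc, hBA, mul_neg]
  refine ⟨?_, ?_, ?_⟩
  · rintro (i | i)
    · refine tprod_prefixTuple_mul_self ?_ i
      rw [mul_assoc, ← mul_assoc sylvesterB, hBA, neg_mul, mul_assoc, sylvesterB_mul_self, mul_one,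
        mul_neg, sylvesterA_mul_self]
      exact (neg_one_smul ℝ _).symm
    · exact tprod_prefixTuple_mul_self (sylvesterB_mul_self.trans (one_smul ℝ _).symm) i
  · have key : ∀ i j : Fin k, m2PowerGen k (Sum.inl i) * m2PowerGen k (Sum.inr j) =
        -(m2PowerGen k (Sum.inr j) * m2PowerGen k (Sum.inl i)) := by
      intro i j
      by_cases h : i = j
      · subst h
        refine tprod_anticomm i ?_ fun l hl => ?_
        · simp only [prefixTuple, lt_irrefl, if_false, if_true]
          rw [← mul_assoc, hBA, neg_mul, neg_neg]
        · simp [prefixTuple, hl]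
      · exact tprod_prefixTuple_anticomm hABA hBA h
    rintro (i | i) (j | j) hij
    · exact tprod_prefixTuple_anticomm hABA hABA (by rintro rfl; exact hij rfl)
    · exact key i j
    · rw [key j i, neg_neg]
    · exact tprod_prefixTuple_anticomm hBA hBA (by rintro rfl; exact hij rfl)
  · rintro (i | i) <;> simp [m2PowerSign]

lemma m2PowerSign_eq (i : Fin k ⊕ Fin k) : m2PowerSign k i = -1 ∨ m2PowerSign k i = 1 := by
  rcases i with i | i <;> simp [m2PowerSign]

lemma negCount_m2PowerSign : negCount (m2PowerSign k) = k := by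
  rw [m2PowerSign, negCount_sumElim]
  norm_num [negCount]

lemma sylvester_mem_m2Grading :
    sylvesterA ∈ m2Grading (1, 0) ∧ sylvesterB ∈ m2Grading (0, 1) ∧
      sylvesterA * sylvesterB ∈ m2Grading (1, 1) ∧ 1 ∈ m2Grading 0 := by
  refine ⟨?_, ?_, ?_, ?_⟩ <;> refine Submodule.mem_span_singleton.2 ⟨1, ?_⟩ <;>
    simp [zmod_two_val_one]

lemma tprod_prefixTuple_mem {c : Matrix (Fin 2) (Fin 2) ℝ} {γ : ZMod 2 × ZMod 2}
    (hc : c ∈ m2Grading γ) (i : Fin k) :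
    PiTensorProduct.tprod ℝ (prefixTuple c i) ∈ m2PowerGrading k (prefixDegree γ i) := by
  refine tprod_mem_m2PowerGrading fun l => ?_
  rw [prefixTuple, prefixDegree]
  split_ifs
  · exact sylvester_mem_m2Grading.1
  · exact hc
  · exact sylvester_mem_m2Grading.2.2.2

lemma m2PowerGen_mem (i : Fin k ⊕ Fin k) :
    m2PowerGen k i ∈ m2PowerGrading k (m2PowerDegree k i) := by
  rcases i with i | i
  · exact tprod_prefixTuple_mem sylvester_mem_m2Grading.2.2.1 i
  · exact tprod_prefixTuple_mem sylvester_mem_m2Grading.2.1 i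

lemma exists_list_sum_iff_closure {ι G : Type*} [AddCommGroup G] (d : ι → G) :
    (∀ g, ∃ l : List ι, (l.map d).sum = g) ↔ AddSubmonoid.closure (Set.range d) = ⊤ := by
  rw [AddSubmonoid.eq_top_iff']
  refine forall_congr' fun g => ⟨?_, fun hg => ?_⟩
  · rintro ⟨l, rfl⟩
    refine list_sum_mem fun a ha => ?_
    obtain ⟨i, -, rfl⟩ := List.mem_map.1 ha
    exact AddSubmonoid.subset_closure ⟨i, rfl⟩
  · induction hg using AddSubmonoid.closure_induction with
    | mem a ha => obtain ⟨i, rfl⟩ := ha; exact ⟨[i], by simp⟩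
    | zero => exact ⟨[], rfl⟩
    | add a b _ _ ha hb =>
      obtain ⟨l, rfl⟩ := ha
      obtain ⟨l', rfl⟩ := hb
      exact ⟨l ++ l', by simp⟩

/-- The two generators at place i have the same prefix, so the sum of their degrees is (1, 0) at i
alone. These sums then clear the prefix of the second generator. -/
lemma closure_range_m2PowerDegree :
    AddSubmonoid.closure (Set.range (m2PowerDegree k)) = ⊤ := by
  set S := AddSubmonoid.closure (Set.range (m2PowerDegree k))
  have hd : ∀ i, m2PowerDegree k i ∈ S := fun i => AddSubmonoid.subset_closure ⟨i, rfl⟩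
  have h1 : ∀ i : Fin k, (Pi.single i (1, 0) : Fin k → ZMod 2 × ZMod 2) ∈ S := by
    intro i
    have h : (Pi.single i (1, 0) : Fin k → ZMod 2 × ZMod 2) =
        m2PowerDegree k (Sum.inl i) + m2PowerDegree k (Sum.inr i) := by
      funext l
      rcases lt_trichotomy l i with h | h | h
      · simp [m2PowerDegree, prefixDegree, h, Pi.single_eq_of_ne h.ne, zmod_two_one_add_one]; rfl
      · subst h; simp [m2PowerDegree, prefixDegree, zmod_two_one_add_one]
      · simp [m2PowerDegree, prefixDegree, h.not_gt, h.ne']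
    rw [h]
    exact add_mem (hd _) (hd _)
  have h2 : ∀ i : Fin k, (Pi.single i (0, 1) : Fin k → ZMod 2 × ZMod 2) ∈ S := by
    intro i
    have h : (Pi.single i (0, 1) : Fin k → ZMod 2 × ZMod 2) =
        m2PowerDegree k (Sum.inr i) +
          ∑ j, (if j < i then (Pi.single j (1, 0) : Fin k → ZMod 2 × ZMod 2) else 0) := by
      funext l
      have hs : (∑ j, (if j < i then (Pi.single j (1, 0) : Fin k → ZMod 2 × ZMod 2) else 0)) l =
          if l < i then (1, 0) else 0 := by
        rw [Finset.sum_apply, Finset.sum_eq_single l]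
        · split_ifs <;> simp
        · intro j _ hj
          split_ifs <;> simp [Pi.single_eq_of_ne hj.symm]
        · simp
      rw [Pi.add_apply, hs]
      rcases lt_trichotomy l i with h | h | h
      · simp [m2PowerDegree, prefixDegree, h, Pi.single_eq_of_ne h.ne, zmod_two_one_add_one]; rfl
      · subst h; simp [m2PowerDegree, prefixDegree]
      · simp [m2PowerDegree, prefixDegree, h.not_gt, h.ne']
    rw [h]
    refine add_mem (hd _) (sum_mem fun j _ => ?_)
    split_ifs
    · exact h1 j
    · exact zero_mem S
  rw [AddSubmonoid.eq_top_iff']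
  intro g
  rw [← Finset.univ_sum_single g]
  refine sum_mem fun i _ => ?_
  obtain ⟨a, b⟩ := g i
  have hab : (Pi.single i (a, b) : Fin k → ZMod 2 × ZMod 2) =
      Pi.single i (a, 0) + Pi.single i (0, b) := by
    rw [← Pi.single_add]; simp
  rw [hab]
  refine add_mem ?_ ?_
  · rcases zmod_two_cases a with rfl | rfl
    · rw [show ((0, 0) : ZMod 2 × ZMod 2) = 0 from rfl, Pi.single_zero]; exact zero_mem S
    · exact h1 i
  · rcases zmod_two_cases b with rfl | rfl
    · rw [show ((0, 0) : ZMod 2 × ZMod 2) = 0 from rfl, Pi.single_zero]; exact zero_mem S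
    · exact h2 i

/-- The product of the matrix entries, as an algebra map to matrices indexed by tuples. -/
noncomputable def m2PowerToMatrix (k : ℕ) :
    M2Power k →ₐ[ℝ] Matrix (Fin k → Fin 2) (Fin k → Fin 2) ℝ :=
  PiTensorProduct.liftAlgHom
    (MultilinearMap.pi fun s => MultilinearMap.pi fun t =>
      (MultilinearMap.mkPiAlgebra ℝ (Fin k) ℝ).compLinearMap fun i =>
        Matrix.entryLinearMap ℝ ℝ (s i) (t i))
    (by
      ext s t
      change ∏ i, (1 : Matrix (Fin 2) (Fin 2) ℝ) (s i) (t i) = _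
      by_cases h : s = t
      · subst h; simp
      · obtain ⟨i, hi⟩ := Function.ne_iff.1 h
        rw [Matrix.one_apply_ne h]
        exact Finset.prod_eq_zero (Finset.mem_univ i) (Matrix.one_apply_ne hi))
    (by
      intro a b
      ext s t
      rw [Matrix.mul_apply]
      change ∏ i, (a i * b i) (s i) (t i) =
        ∑ r : Fin k → Fin 2, (∏ i, a i (s i) (r i)) * ∏ i, b i (r i) (t i)
      simp only [Matrix.mul_apply, Finset.prod_univ_sum, Fintype.piFinset_univ,
        Finset.prod_mul_distrib])

instance : Nontrivial (M2Power k) :=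
  (m2PowerToMatrix k).toRingHom.domain_nontrivial

lemma even_card_sum_self : Even (Fintype.card (Fin k ⊕ Fin k)) := ⟨k, by simp⟩

lemma exists_addEquiv_m2Power :
    Algebra.adjoin ℝ (Set.range (m2PowerGen k)) = ⊤ ∧
    ∃ e : (Fin k ⊕ Fin k → ZMod 2) ≃+ (Fin k → ZMod 2 × ZMod 2),
      (∀ i, e (Pi.single i 1) = m2PowerDegree k i) ∧
      ∀ g, standardGrading (m2PowerGen k) g = m2PowerGrading k (e g) := by
  have := m2PowerGrading_gradedMonoid (k := k)
  exact isAnticommSystem_m2PowerGen.exists_addEquiv even_card_sum_self (m2PowerGrading k)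
    (fun g => funext fun i => Prod.ext (CharTwo.add_self_eq_zero _) (CharTwo.add_self_eq_zero _))
    (fun g => ⟨_, m2PowerGrading_eq_span g⟩) iSup_m2PowerGrading (m2PowerDegree k) m2PowerGen_mem
    ((exists_list_sum_iff_closure _).2 closure_range_m2PowerDegree)

/-- The Kronecker map carries the generators to a system in the matrix algebra, which has dimension
2^(2k) and is therefore generated by it. Both algebras are thus generated by systems with the same
squares. -/
lemma nonempty_m2Power_algEquiv_matrix :
    Nonempty (M2Power k ≃ₐ[ℝ] Matrix (Fin (2 ^ k)) (Fin (2 ^ k)) ℝ) := by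
  have h := isAnticommSystem_m2PowerGen (k := k)
  have h' := h.map (m2PowerToMatrix k)
  obtain ⟨φ, -⟩ := h.exists_algEquiv h' even_card_sum_self exists_addEquiv_m2Power.1
    (h'.adjoin_eq_top even_card_sum_self (by
      rw [Module.finrank_matrix, Module.finrank_self, Fintype.card_sum, Fintype.card_fin,
        Fintype.card_fun, Fintype.card_fin, Fintype.card_fin, pow_add, mul_one]))
    (Equiv.refl _) (fun _ => rfl)
  exact ⟨φ.trans (Matrix.reindexAlgEquiv ℝ ℝ (Fintype.equivOfCardEq (by simp)))⟩

end M2Power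

/-! ### Tensor products of gradings -/

section Tensor

variable {G H R S : Type*} [Ring R] [Algebra ℝ R] [Ring S]
  [Algebra ℝ S] {𝒜 : G → Submodule ℝ R} {ℬ : H → Submodule ℝ S}

lemma tmul_mem_tensorGrading {g : G} {h : H} {a : R} {b : S} (ha : a ∈ 𝒜 g) (hb : b ∈ ℬ h) :
    a ⊗ₜ[ℝ] b ∈ tensorGrading 𝒜 ℬ (g, h) :=
  Submodule.subset_span ⟨a, ha, b, hb, rfl⟩

lemma tensorGrading_gradedMonoid [AddCommGroup G] [AddCommGroup H] [SetLike.GradedMonoid 𝒜] [SetLike.GradedMonoid ℬ] :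
    SetLike.GradedMonoid (tensorGrading 𝒜 ℬ) where
  one_mem := tmul_mem_tensorGrading (SetLike.GradedOne.one_mem (A := 𝒜))
    (SetLike.GradedOne.one_mem (A := ℬ))
  mul_mem := by
    rintro g h x y hx hy
    refine mul_mem_of_mem_span ?_ hx hy
    rintro _ ⟨a, ha, b, hb, rfl⟩ _ ⟨c, hc, d, hd, rfl⟩
    rw [Algebra.TensorProduct.tmul_mul_tmul]
    exact tmul_mem_tensorGrading (SetLike.GradedMul.mul_mem ha hc) (SetLike.GradedMul.mul_mem hb hd)

lemma exists_tensorGrading_eq_span (h𝒜 : ∀ g, ∃ a, 𝒜 g = Submodule.span ℝ {a})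
    (hℬ : ∀ g, ∃ a, ℬ g = Submodule.span ℝ {a}) (g : G × H) :
    ∃ a, tensorGrading 𝒜 ℬ g = Submodule.span ℝ {a} := by
  obtain ⟨a, ha⟩ := h𝒜 g.1
  obtain ⟨b, hb⟩ := hℬ g.2
  refine ⟨a ⊗ₜ[ℝ] b, le_antisymm (Submodule.span_le.2 ?_)
    ((Submodule.span_singleton_le_iff_mem _ _).2 (tmul_mem_tensorGrading
      (ha ▸ Submodule.mem_span_singleton_self a) (hb ▸ Submodule.mem_span_singleton_self b)))⟩
  rintro _ ⟨x, hx, y, hy, rfl⟩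
  rw [ha] at hx
  rw [hb] at hy
  obtain ⟨c, rfl⟩ := Submodule.mem_span_singleton.1 hx
  obtain ⟨d, rfl⟩ := Submodule.mem_span_singleton.1 hy
  rw [TensorProduct.smul_tmul_smul]
  exact Submodule.smul_mem _ _ (Submodule.mem_span_singleton_self _)

lemma iSup_tensorGrading (h𝒜 : ⨆ g, 𝒜 g = ⊤) (hℬ : ⨆ g, ℬ g = ⊤) :
    ⨆ g, tensorGrading 𝒜 ℬ g = ⊤ := by
  rw [eq_top_iff]
  rintro t -
  induction t using TensorProduct.induction_on with
  | zero => exact zero_mem _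
  | add a b ha hb => exact add_mem ha hb
  | tmul a b =>
    have ha : a ∈ ⨆ g, 𝒜 g := h𝒜 ▸ Submodule.mem_top
    have hb : b ∈ ⨆ g, ℬ g := hℬ ▸ Submodule.mem_top
    induction ha using Submodule.iSup_induction' with
    | zero => rw [TensorProduct.zero_tmul]; exact zero_mem _
    | add x y _ _ hx hy => rw [TensorProduct.add_tmul]; exact add_mem hx hy
    | mem g x hx =>
      induction hb using Submodule.iSup_induction' with
      | zero => rw [TensorProduct.tmul_zero]; exact zero_mem _
      | add y z _ _ hy hz => rw [TensorProduct.tmul_add]; exact add_mem hy hz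
      | mem h y hy => exact le_iSup (tensorGrading 𝒜 ℬ) (g, h) (tmul_mem_tensorGrading hx hy)

/-- A system in `R` and two anticommuting square roots of `-1` in `S` give a system in
`R ⊗ S`. -/
lemma IsAnticommSystem.tensor {ι : Type*} {ε : ι → ℝ} {x : ι → R} (h : IsAnticommSystem ε x)
    {ω : R} (hω : ∀ i, ω * x i = -(x i * ω)) (hωω : ω * ω = 1) {a b : S}
    (haa : a * a = algebraMap ℝ S (-1)) (hbb : b * b = algebraMap ℝ S (-1))
    (hab : a * b = -(b * a)) :
    IsAnticommSystem (Sum.elim ε ![-1, -1])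
      (Sum.elim (fun i => x i ⊗ₜ[ℝ] (1 : S)) ![ω ⊗ₜ a, ω ⊗ₜ b]) := by
  have hq : ∀ q : S, q * q = algebraMap ℝ S (-1) →
      ((1 : R) ⊗ₜ[ℝ] q) * (1 ⊗ₜ q) = algebraMap ℝ (R ⊗[ℝ] S) (-1) := by
    intro q hq
    rw [Algebra.TensorProduct.tmul_mul_tmul, one_mul, hq, Algebra.algebraMap_eq_smul_one,
      Algebra.algebraMap_eq_smul_one, TensorProduct.tmul_smul, Algebra.TensorProduct.one_def]
  -- An instance of `extend` with top ω ⊗ 1 and the pair 1 ⊗ a, 1 ⊗ b.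
  have h' := (h.map (Algebra.TensorProduct.includeLeft : R →ₐ[ℝ] R ⊗[ℝ] S)).extend
    (ω := ω ⊗ₜ 1) (a := 1 ⊗ₜ a) (b := 1 ⊗ₜ b) (s := 1) (α := -1) (β := -1)
    (fun i => by
      simp only [Function.comp_apply, Algebra.TensorProduct.includeLeft_apply,
        Algebra.TensorProduct.tmul_mul_tmul, hω, TensorProduct.neg_tmul])
    (by rw [Algebra.TensorProduct.tmul_mul_tmul, hωω, one_mul, map_one,
      Algebra.TensorProduct.one_def])
    one_ne_zero (fun i => by simp) (fun i => by simp) (by simp) (by simp)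
    (hq _ haa) (by norm_num) (hq _ hbb) (by norm_num)
    (by
      rw [Algebra.TensorProduct.tmul_mul_tmul, Algebra.TensorProduct.tmul_mul_tmul, hab,
        TensorProduct.tmul_neg])
  simp only [Algebra.TensorProduct.tmul_mul_tmul, one_mul, mul_one] at h'
  exact h'

end Tensor

/-! ### The grading `(M_2^(4))^{⊗ n} ⊗ ℍ^(4)` -/

section M2PowerQuaternion

variable (n : ℕ)

/-- The pure tensor all of whose factors are `A`. -/
noncomputable def m2PowerTop : M2Power n := PiTensorProduct.tprod ℝ fun _ => sylvesterA

lemma m2PowerTop_mul_self : m2PowerTop n * m2PowerTop n = 1 := by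
  rw [m2PowerTop, PiTensorProduct.tprod_mul_tprod, PiTensorProduct.one_def]
  congr 1
  funext i
  exact sylvesterA_mul_self

/-- Only place i matters, where A meets AB or B; elsewhere A meets A or 1. -/
lemma m2PowerTop_anticomm (i : Fin n ⊕ Fin n) :
    m2PowerTop n * m2PowerGen n i = -(m2PowerGen n i * m2PowerTop n) := by
  have key : ∀ (c : Matrix (Fin 2) (Fin 2) ℝ) (i : Fin n),
      sylvesterA * c = -(c * sylvesterA) →
      m2PowerTop n * PiTensorProduct.tprod ℝ (prefixTuple c i) =
        -(PiTensorProduct.tprod ℝ (prefixTuple c i) * m2PowerTop n) := by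
    intro c i hc
    refine tprod_anticomm i (by simpa [prefixTuple] using hc) fun l hl => ?_
    rcases lt_or_gt_of_ne hl with h | h
    · simp [prefixTuple, h]
    · simp [prefixTuple, h.not_gt, h.ne']
  have hBA := sylvesterB_mul_sylvesterA
  rcases i with i | i
  · exact key _ i (by rw [mul_assoc, hBA, mul_neg, neg_neg])
  · exact key _ i (by rw [hBA, neg_neg])

lemma m2PowerTop_mem : m2PowerTop n ∈ m2PowerGrading n fun _ => (1, 0) :=
  tprod_mem_m2PowerGrading fun _ => sylvester_mem_m2Grading.1

/-- The generators of `M_2(ℝ)^{⊗ n} ⊗ ℍ`. -/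
noncomputable def m2PowerQuaternionGen :
    (Fin n ⊕ Fin n) ⊕ Fin 2 → M2Power n ⊗[ℝ] ℍ[ℝ] :=
  Sum.elim (fun i => m2PowerGen n i ⊗ₜ 1)
    ![m2PowerTop n ⊗ₜ quaternionI, m2PowerTop n ⊗ₜ quaternionJ]

/-- The degrees of the generators of `M_2(ℝ)^{⊗ n} ⊗ ℍ`. -/
def m2PowerQuaternionDegree :
    (Fin n ⊕ Fin n) ⊕ Fin 2 → (Fin n → ZMod 2 × ZMod 2) × (ZMod 2 × ZMod 2) :=
  Sum.elim (fun i => (m2PowerDegree n i, 0))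
    ![(fun _ => (1, 0), (1, 0)), (fun _ => (1, 0), (0, 1))]

/-- The squares of the generators of `M_2(ℝ)^{⊗ n} ⊗ ℍ`. -/
noncomputable def m2PowerQuaternionSign : (Fin n ⊕ Fin n) ⊕ Fin 2 → ℝ :=
  Sum.elim (m2PowerSign n) ![-1, -1]

lemma isAnticommSystem_m2PowerQuaternionGen :
    IsAnticommSystem (m2PowerQuaternionSign n) (m2PowerQuaternionGen n) := by
  exact isAnticommSystem_m2PowerGen.tensor (m2PowerTop_anticomm n) (m2PowerTop_mul_self n)
    quaternionI_mul_self quaternionJ_mul_self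
    (by rw [quaternionJ_mul_quaternionI, neg_neg])

lemma m2PowerQuaternionSign_eq (i) :
    m2PowerQuaternionSign n i = -1 ∨ m2PowerQuaternionSign n i = 1 := by
  rcases i with i | i
  · exact m2PowerSign_eq i
  · left; fin_cases i <;> rfl

lemma negCount_m2PowerQuaternionSign : negCount (m2PowerQuaternionSign n) = n + 2 := by
  rw [m2PowerQuaternionSign, negCount_sumElim, negCount_m2PowerSign, negCount_pair]
  simp

lemma quaternion_mem_quaternionGrading :
    quaternionI ∈ quaternionGrading (1, 0) ∧ quaternionJ ∈ quaternionGrading (0, 1) ∧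
      1 ∈ quaternionGrading 0 := by
  refine ⟨Submodule.mem_span_singleton.2 ⟨1, (one_smul ℝ _).trans ?_⟩,
    Submodule.mem_span_singleton.2 ⟨1, (one_smul ℝ _).trans ?_⟩,
    Submodule.mem_span_singleton.2 ⟨1, (one_smul ℝ _).trans ?_⟩⟩
  · simp [zmod_two_val_one, quaternionI]
    rfl
  · simp [zmod_two_val_one, quaternionJ]
    rfl
  · simp
    rfl

lemma m2PowerQuaternionGen_mem (i) : m2PowerQuaternionGen n i ∈
    tensorGrading (m2PowerGrading n) quaternionGrading (m2PowerQuaternionDegree n i) := by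
  rcases i with i | i
  · exact tmul_mem_tensorGrading (m2PowerGen_mem i) quaternion_mem_quaternionGrading.2.2
  · fin_cases i
    · exact tmul_mem_tensorGrading (m2PowerTop_mem n) quaternion_mem_quaternionGrading.1
    · exact tmul_mem_tensorGrading (m2PowerTop_mem n) quaternion_mem_quaternionGrading.2.1

/-- The degrees of the matrix part already span the first factor, so the degree of the top tensor
can be cancelled from those of the two quaternionic generators. -/
lemma closure_range_m2PowerQuaternionDegree :
    AddSubmonoid.closure (Set.range (m2PowerQuaternionDegree n)) = ⊤ := by
  set S := AddSubmonoid.closure (Set.range (m2PowerQuaternionDegree n))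
  have hd : ∀ i, m2PowerQuaternionDegree n i ∈ S := fun i => AddSubmonoid.subset_closure ⟨i, rfl⟩
  have h1 : ∀ g : Fin n → ZMod 2 × ZMod 2, (g, (0 : ZMod 2 × ZMod 2)) ∈ S := by
    intro g
    obtain ⟨l, rfl⟩ := (exists_list_sum_iff_closure _).2 (closure_range_m2PowerDegree (k := n)) g
    induction l with
    | nil => exact zero_mem S
    | cons a l ih =>
      have := add_mem (hd (Sum.inl a)) ih
      simpa [m2PowerQuaternionDegree] using this
  have hc : (fun _ => (1, 0) : Fin n → ZMod 2 × ZMod 2) + (fun _ => (1, 0)) = 0 := by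
    funext i; exact Prod.ext zmod_two_one_add_one (add_zero 0)
  have h2 : ∀ γ : ZMod 2 × ZMod 2,
      ((fun _ => (1, 0) : Fin n → ZMod 2 × ZMod 2), γ) ∈ S → ((0 : Fin n → ZMod 2 × ZMod 2), γ) ∈ S := by
    intro γ h
    have := add_mem (h1 fun _ => (1, 0)) h
    rwa [Prod.mk_add_mk, hc, zero_add] at this
  have h3 := h2 (1, 0) (hd (Sum.inr 0))
  have h4 := h2 (0, 1) (hd (Sum.inr 1))
  rw [AddSubmonoid.eq_top_iff']
  rintro ⟨g, a, b⟩
  have hb : ((0 : Fin n → ZMod 2 × ZMod 2), (a, b)) ∈ S := by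
    rcases zmod_two_cases a with rfl | rfl <;> rcases zmod_two_cases b with rfl | rfl
    · exact zero_mem S
    · exact h4
    · exact h3
    · have := add_mem h3 h4
      rwa [Prod.mk_add_mk, Prod.mk_add_mk, add_zero, add_zero, zero_add] at this
  have := add_mem (h1 g) hb
  rwa [Prod.mk_add_mk, add_zero, zero_add] at this

lemma nonempty_m2PowerQuaternion_algEquiv_matrix :
    Nonempty (M2Power n ⊗[ℝ] ℍ[ℝ] ≃ₐ[ℝ] Matrix (Fin (2 ^ n)) (Fin (2 ^ n)) ℍ[ℝ]) := by
  obtain ⟨φ⟩ := nonempty_m2Power_algEquiv_matrix (k := n)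
  exact ⟨(Algebra.TensorProduct.comm ℝ _ _).trans
    ((Algebra.TensorProduct.congr AlgEquiv.refl φ).trans
      (matrixEquivTensor (Fin (2 ^ n)) ℝ ℍ[ℝ]).symm)⟩

instance : Nontrivial (M2Power n ⊗[ℝ] ℍ[ℝ]) := by
  obtain ⟨φ⟩ := nonempty_m2PowerQuaternion_algEquiv_matrix n
  exact φ.toEquiv.nontrivial

lemma even_card_m2PowerQuaternion : Even (Fintype.card ((Fin n ⊕ Fin n) ⊕ Fin 2)) :=
  ⟨n + 1, by simp; ring⟩

lemma exists_addEquiv_m2PowerQuaternion :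
    Algebra.adjoin ℝ (Set.range (m2PowerQuaternionGen n)) = ⊤ ∧
    ∃ e : ((Fin n ⊕ Fin n) ⊕ Fin 2 → ZMod 2) ≃+ (Fin n → ZMod 2 × ZMod 2) × (ZMod 2 × ZMod 2),
      (∀ i, e (Pi.single i 1) = m2PowerQuaternionDegree n i) ∧
      ∀ g, standardGrading (m2PowerQuaternionGen n) g =
        tensorGrading (m2PowerGrading n) quaternionGrading (e g) := by
  have := m2PowerGrading_gradedMonoid (k := n)
  have := quaternionGrading_gradedMonoid
  have := tensorGrading_gradedMonoid (𝒜 := m2PowerGrading n) (ℬ := quaternionGrading)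
  have h2 : ∀ γ : ZMod 2 × ZMod 2, γ + γ = 0 := fun γ =>
    Prod.ext (CharTwo.add_self_eq_zero _) (CharTwo.add_self_eq_zero _)
  exact (isAnticommSystem_m2PowerQuaternionGen n).exists_addEquiv (even_card_m2PowerQuaternion n)
    (tensorGrading (m2PowerGrading n) quaternionGrading)
    (fun g => Prod.ext (funext fun i => h2 _) (h2 _))
    (exists_tensorGrading_eq_span (fun g => ⟨_, m2PowerGrading_eq_span g⟩) fun g => ⟨_, rfl⟩)
    (iSup_tensorGrading iSup_m2PowerGrading iSup_quaternionGrading)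
    (m2PowerQuaternionDegree n) (m2PowerQuaternionGen_mem n)
    ((exists_list_sum_iff_closure _).2 (closure_range_m2PowerQuaternionDegree n))

end M2PowerQuaternion

/-! ### The graded Clifford algebras -/

lemma negCount_firstNegative {n p : ℕ} (hp : p ≤ n) : negCount (firstNegative n p) = p := by
  rw [negCount_eq_card]
  refine (Nat.card_congr (Equiv.subtypeEquivRight fun i => ?_)).trans
    (Nat.card_eq_fintype_card.trans (card_lt_filter n p hp))
  rw [firstNegative]
  split_ifs with h
  · simp [h]
  · simp only [h, iff_false]; norm_num

/-- The basic properties of the graded Clifford algebras with an even number of generators. -/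
lemma cliffGrading_properties {p m k : ℕ} (hpm : p + m = 2 * k) :
    Nonempty (GradedAlgebra (cliffGrading p m)) ∧ IsDivisionGrading (cliffGrading p m) ∧
      IsFineGrading (cliffGrading p m) ∧ (∀ g, Module.finrank ℝ (cliffGrading p m g) = 1) ∧
      HasAnticommPresentation (firstNegative (2 * k) p) (cliffGrading p m) := by
  have h := isAnticommSystem_cliffGen p m
  have hev : Even (Fintype.card (Fin (p + m))) := ⟨k, by rw [Fintype.card_fin]; omega⟩
  have hgen := adjoin_cliffGen p m
  refine ⟨h.nonempty_gradedAlgebra hev hgen, h.isDivisionGrading,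
    isFineGrading_of_finrank_eq_one _ h.finrank_standardGrading, h.finrank_standardGrading, ?_⟩
  exact (equivalent_and_presentation_of_system h (firstNegative_eq _ _) hgen hpm
    (by rw [Fintype.card_fin, hpm]) (negCount_firstNegative (by omega)) (cliffGrading p m)
    (AddEquiv.refl _) fun _ => rfl).2.2.2

theorem mainTheorem3 :
    -- classification of fine division gradings on central simple real algebras
    (∀ (G : Type u) [AddCommGroup G] [DecidableEq G] (R : Type v) [Ring R] [Algebra ℝ R]
        [FiniteDimensional ℝ R] [Algebra.IsCentral ℝ R] [IsSimpleRing R]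
        (𝒜 : G → Submodule ℝ R) [GradedAlgebra 𝒜],
        AddSubgroup.closure (gradingSupport 𝒜) = ⊤ →
        IsDivisionGrading 𝒜 → IsFineGrading 𝒜 →
        (∀ g : G, Module.finrank ℝ (𝒜 g) = 1) ∧
        (∀ g : G, g + g = 0) ∧
        ((∃ k : ℕ, GradingEquivalent 𝒜 (cliffGrading k k) ∧
            HasAnticommPresentation (firstNegative (2 * k) k) 𝒜) ∨
          (∃ k : ℕ, 1 ≤ k ∧ GradingEquivalent 𝒜 (cliffGrading (k + 1) (k - 1)) ∧
            HasAnticommPresentation (firstNegative (2 * k) (k + 1)) 𝒜))) ∧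
    -- the first family
    (∀ k : ℕ,
        Nonempty (GradedAlgebra (cliffGrading k k)) ∧
        IsDivisionGrading (cliffGrading k k) ∧
        IsFineGrading (cliffGrading k k) ∧
        (∀ g, Module.finrank ℝ (cliffGrading k k g) = 1) ∧
        Nonempty (Cliff k k ≃ₐ[ℝ] Matrix (Fin (2 ^ k)) (Fin (2 ^ k)) ℝ) ∧
        GradingEquivalent (cliffGrading k k) (m2PowerGrading k) ∧
        HasAnticommPresentation (firstNegative (2 * k) k) (cliffGrading k k)) ∧
    -- the second family
    (∀ k : ℕ, 1 ≤ k →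
        Nonempty (GradedAlgebra (cliffGrading (k + 1) (k - 1))) ∧
        IsDivisionGrading (cliffGrading (k + 1) (k - 1)) ∧
        IsFineGrading (cliffGrading (k + 1) (k - 1)) ∧
        (∀ g, Module.finrank ℝ (cliffGrading (k + 1) (k - 1) g) = 1) ∧
        Nonempty (Cliff (k + 1) (k - 1) ≃ₐ[ℝ]
          Matrix (Fin (2 ^ (k - 1))) (Fin (2 ^ (k - 1))) ℍ[ℝ]) ∧
        GradingEquivalent (cliffGrading (k + 1) (k - 1))
          (tensorGrading (m2PowerGrading (k - 1)) quaternionGrading) ∧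
        HasAnticommPresentation (firstNegative (2 * k) (k + 1)) (cliffGrading (k + 1) (k - 1))) := by
  refine ⟨?_, fun k => ?_, fun k hk => ?_⟩
  · intro G _ _ R _ _ _ _ _ 𝒜 _ hs hd hf
    exact classification_of_isFineGrading 𝒜 hs hd hf
  · obtain ⟨h1, h2, h3, h4, h5⟩ := cliffGrading_properties (two_mul k).symm
    obtain ⟨hgen, e, -, he⟩ := exists_addEquiv_m2Power (k := k)
    obtain ⟨⟨φ⟩, h6, -⟩ := equivalent_and_presentation_of_system isAnticommSystem_m2PowerGen
      m2PowerSign_eq hgen (two_mul k).symm (by simp [two_mul]) negCount_m2PowerSign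
      (m2PowerGrading k) e he
    obtain ⟨ψ⟩ := nonempty_m2Power_algEquiv_matrix (k := k)
    exact ⟨h1, h2, h3, h4, ⟨φ.trans ψ⟩, h6, h5⟩
  -- With n = k - 1 matrix factors the model has n + 2 = k + 1 negative squares; 1 ≤ k makes the
  -- subtraction exact.
  · have hpm : k + 1 + (k - 1) = 2 * k := by omega
    obtain ⟨h1, h2, h3, h4, h5⟩ := cliffGrading_properties hpm
    obtain ⟨hgen, e, -, he⟩ := exists_addEquiv_m2PowerQuaternion (k - 1)
    obtain ⟨⟨φ⟩, h6, -⟩ := equivalent_and_presentation_of_system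
      (isAnticommSystem_m2PowerQuaternionGen (k - 1)) (m2PowerQuaternionSign_eq (k - 1)) hgen hpm
      (by simp; omega) ((negCount_m2PowerQuaternionSign (k - 1)).trans (by omega)) _ e he
    obtain ⟨ψ⟩ := nonempty_m2PowerQuaternion_algEquiv_matrix (k - 1)
    exact ⟨h1, h2, h3, h4, ⟨φ.trans ψ⟩, h6, h5⟩
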